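/- All metric spaces carry real-valued (finite) metrics, and $B(x,r)$ denotes the closed ball $\{y : d(x,y)\le r\}$. A metric space $X$ is \emph{hyperconvex} if for every collection of closed balls $\{B(x_i,r_i)\}_{i\in I}$ in $X$ with $d(x_i,x_j)\le r_i+r_j$ for all $i,j\in I$ one has $\bigcap_{i\in I}B(x_i,r_i)\neq\emptyset$. A non-empty subset $A$ of a metric space $X$ is \emph{externally hyperconvex} in $X$ if for every collection of closed balls $\{B(x_i,r_i)\}_{i\in I}$ in $X$ with $d(x_i,x_j)\le r_i+r_j$ and $d(x_i,A)\le r_i$ for all $i,j\in I$ one has $A\cap\bigcap_{i\in I}B(x_i,r_i)\neq\emptyset$; it is \emph{weakly externally hyperconvex} in $X$ if for every $x\in X$ it is externally hyperconvex in the subspace $A\cup\{x\}$. \textbf{Theorem.} Let $X_0$ be a hyperconvex metric space and let $\{X_\lambda\}_{\lambda\in\Lambda}$ be a family of hyperconvex metric spaces. For each $\lambda\in\Lambda$ let $A_\lambda$ be a metric space with isometric embeddings $\iota_\lambda\colon A_\lambda\to X_\lambda$ and $\kappa_\lambda\colon A_\lambda\to X_0$ such that $\iota_\lambda(A_\lambda)$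 is weakly externally hyperconvex in $X_\lambda$ and $\kappa_\lambda(A_\lambda)$ is weakly externally hyperconvex in $X_0$, and suppose that $\kappa_\lambda(A_\lambda)\cap\kappa_{\lambda'}(A_{\lambda'})=\emptyset$ for $\lambda\neq\lambda'$. Suppose further that for every $\lambda\in\Lambda$, \begin{itemize} \item for every $x\in X_\lambda$, the set $\kappa_\lambda\bigl(\iota_\lambda^{-1}\bigl(B(x,d(x,\iota_\lambda(A_\lambda)))\bigr)\bigr)$ (the copy in $X_0$ of $B(x,d(x,A_\lambda))\cap A_\lambda$) is externally hyperconvex in $X_0$, and \item for every $x\in X_0$, the set $\iota_\lambda\bigl(\kappa_\lambda^{-1}\bigl(B(x,d(x,\kappa_\lambda(A_\lambda)))\bigr)\bigr)$ (the copy in $X_\lambda$ of $B(x,d(x,A_\lambda))\cap A_\lambda$) is externally hyperconvex in $X_\lambda$. \end{itemize} Let $X=X_0\bigsqcup_{\{A_\lambda:\lambda\in\Lambda\}}X_\lambda$ be the quotient of the disjoint union of $X_0$ and all the $X_\lambda$ by the equivalence relation generated by $\kappa_\lambda(a)\sim\iota_\lambda(a)$ ($\lambda\in\Lambda$, $a\in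 A_\lambda$), with the gluing metric: $d$ restricts to the given metric on $X_0$ and on each $X_\lambda$; for $x\in X_\lambda$ and $y\in X_0$, \[ d(x,y)=\inf_{a\in A_\lambda}\bigl(d(x,\iota_\lambda(a))+d(\kappa_\lambda(a),y)\bigr); \] and for $x\in X_\lambda$, $y\in X_{\lambda'}$ with $\lambda\neq\lambda'$, \[ d(x,y)=\inf_{a\in A_\lambda,\ b\in A_{\lambda'}}\bigl(d(x,\iota_\lambda(a))+d(\kappa_\lambda(a),\kappa_{\lambda'}(b))+d(\iota_{\lambda'}(b),y)\bigr). \] Then $X$ is hyperconvex. -/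

import Mathlib

open Metric Set

/-- A metric space is hyperconvex if every collection of closed balls `B(x_i, r_i)` with
`d(x_i, x_j) ≤ r_i + r_j` for all `i, j` has a common point.  A collection of balls is recorded as
a set of pairs (centre, radius); taking `i = j` shows that the radii are nonnegative. -/
def IsHyperconvex (X : Type*) [MetricSpace X] : Prop :=
  ∀ S : Set (X × ℝ), (∀ p ∈ S, ∀ q ∈ S, dist p.1 q.1 ≤ p.2 + q.2) →
    (⋂ p ∈ S, closedBall p.1 p.2).Nonempty

/-- For subsets `A ⊆ Y` of a metric space `X`: the set `A` is externally hyperconvex in the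
subspace `Y`, i.e. `A` is nonempty and for every collection of closed balls with centres `x_i ∈ Y`,
`d(x_i, x_j) ≤ r_i + r_j` and `d(x_i, A) ≤ r_i`, the balls have a common point in `A`. -/
def IsExternallyHyperconvexIn {X : Type*} [MetricSpace X] (A Y : Set X) : Prop :=
  A ⊆ Y ∧ A.Nonempty ∧
    ∀ S : Set (X × ℝ), (∀ p ∈ S, p.1 ∈ Y) →
      (∀ p ∈ S, ∀ q ∈ S, dist p.1 q.1 ≤ p.2 + q.2) →
      (∀ p ∈ S, infDist p.1 A ≤ p.2) →
        (A ∩ ⋂ p ∈ S, closedBall p.1 p.2).Nonempty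

/-- `A` is externally hyperconvex in the whole space `X`. -/
def IsExternallyHyperconvex {X : Type*} [MetricSpace X] (A : Set X) : Prop :=
  IsExternallyHyperconvexIn A univ

/-- `A` is weakly externally hyperconvex in `X`: it is nonempty and, for every `x ∈ X`, it is
externally hyperconvex in the subspace `A ∪ {x}`. -/
def IsWeaklyExternallyHyperconvex {X : Type*} [MetricSpace X] (A : Set X) : Prop :=
  A.Nonempty ∧ ∀ x : X, IsExternallyHyperconvexIn A (A ∪ {x})

theorem IsWeaklyExternallyHyperconvex.isClosed {X : Type*} [MetricSpace X] {A : Set X}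
    (h : IsWeaklyExternallyHyperconvex A) : IsClosed A := by
  refine isClosed_of_closure_subset fun x hx => ?_
  have h0 : infDist x A = 0 := (mem_closure_iff_infDist_zero h.1).1 hx
  obtain ⟨-, -, h3⟩ := h.2 x
  obtain ⟨a, haA, ha⟩ := h3 {(x, 0)} (by simp) (by simp) (by simp [h0])
  have hax : a = x := by simpa using ha
  exact hax ▸ haA

theorem IsWeaklyExternallyHyperconvex.nonempty_of_range {A X : Type*} [MetricSpace X] {f : A → X}
    (h : IsWeaklyExternallyHyperconvex (range f)) : Nonempty A :=
  range_nonempty_iff_nonempty.1 h.1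

section Gluing

universe u v w z

variable {X₀ : Type u} {Λ : Type v} {X : Λ → Type w} {A : Λ → Type z}

/-- The identifications on the disjoint union of `X₀` and all the `X i`: for each `a : A i`, its
copy `κ i a` in `X₀` is identified with its copy `ι i a` in `X i`. -/
inductive GlueRel (κ : ∀ i, A i → X₀) (ι : ∀ i, A i → X i) :
    X₀ ⊕ (Σ i, X i) → X₀ ⊕ (Σ i, X i) → Prop
  | glue (i : Λ) (a : A i) : GlueRel κ ι (Sum.inl (κ i a)) (Sum.inr ⟨i, ι i a⟩)

/-- The space obtained by gluing each `X i` to `X₀` along `A i`: the quotient of the disjoint union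
by the equivalence relation generated by the identifications `κ i a ∼ ι i a`. -/
def Glued (κ : ∀ i, A i → X₀) (ι : ∀ i, A i → X i) : Type (max u v w) :=
  Quot (GlueRel κ ι)

variable [MetricSpace X₀] [∀ i, MetricSpace (X i)]

open Classical in
/-- The gluing distance on the disjoint union: the original distance for two points of the same
piece, and otherwise the infimum of the lengths of the routes through the gluing sets. -/
noncomputable def glueDistance (κ : ∀ i, A i → X₀) (ι : ∀ i, A i → X i) :
    X₀ ⊕ (Σ i, X i) → X₀ ⊕ (Σ i, X i) → ℝ
  | .inl x, .inl y => dist x y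
  | .inl x, .inr ⟨i, y⟩ => ⨅ a : A i, (dist x (κ i a) + dist (ι i a) y)
  | .inr ⟨i, x⟩, .inl y => ⨅ a : A i, (dist x (ι i a) + dist (κ i a) y)
  | .inr ⟨i, x⟩, .inr ⟨j, y⟩ =>
      if h : i = j then dist (cast (congrArg X h) x) y
      else ⨅ p : A i × A j,
        (dist x (ι i p.1) + dist (κ i p.1) (κ j p.2) + dist (ι j p.2) y)

theorem glueDistance_self (κ : ∀ i, A i → X₀) (ι : ∀ i, A i → X i) (p : X₀ ⊕ (Σ i, X i)) :
    glueDistance κ ι p p = 0 := by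
  rcases p with x | ⟨i, x⟩ <;> simp [glueDistance]

theorem glueDistance_comm (κ : ∀ i, A i → X₀) (ι : ∀ i, A i → X i) (p q : X₀ ⊕ (Σ i, X i)) :
    glueDistance κ ι p q = glueDistance κ ι q p := by
  rcases p with x | ⟨i, x⟩ <;> rcases q with y | ⟨j, y⟩
  · exact dist_comm x y
  · simp only [glueDistance]
    congr 1; ext a; rw [add_comm, dist_comm x, dist_comm y]
  · simp only [glueDistance]
    congr 1; ext a; rw [add_comm, dist_comm x, dist_comm y]
  · by_cases h : i = j
    · subst h; simp [glueDistance, dist_comm]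
    · simp only [glueDistance, dif_neg h, dif_neg (Ne.symm h)]
      rw [← (Equiv.prodComm (A i) (A j)).iInf_comp]
      congr 1; ext a
      simp only [Equiv.prodComm_apply, Prod.fst_swap, Prod.snd_swap]
      rw [dist_comm x, dist_comm y, dist_comm (κ i a.1)]; ring

theorem glueDistance_zero_zero (κ : ∀ i, A i → X₀) (ι : ∀ i, A i → X i) (x y : X₀) :
    glueDistance κ ι (.inl x) (.inl y) = dist x y := rfl

theorem glueDistance_same (κ : ∀ i, A i → X₀) (ι : ∀ i, A i → X i) (i : Λ) (x y : X i) :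
    glueDistance κ ι (.inr ⟨i, x⟩) (.inr ⟨i, y⟩) = dist x y := by
  simp [glueDistance]

theorem glueDistance_zero_le (κ : ∀ i, A i → X₀) (ι : ∀ i, A i → X i) (x : X₀) (i : Λ) (y : X i)
    (a : A i) : glueDistance κ ι (.inl x) (.inr ⟨i, y⟩) ≤ dist x (κ i a) + dist (ι i a) y :=
  ciInf_le (f := fun a : A i => dist x (κ i a) + dist (ι i a) y)
    ⟨0, by rintro _ ⟨a, rfl⟩; positivity⟩ a

theorem exists_lt_of_glueDistance_zero_lt [∀ i, Nonempty (A i)] (κ : ∀ i, A i → X₀)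
    (ι : ∀ i, A i → X i) (x : X₀) (i : Λ) (y : X i) {c : ℝ}
    (h : glueDistance κ ι (.inl x) (.inr ⟨i, y⟩) < c) :
    ∃ a : A i, dist x (κ i a) + dist (ι i a) y < c :=
  exists_lt_of_ciInf_lt h

theorem glueDistance_ne_le (κ : ∀ i, A i → X₀) (ι : ∀ i, A i → X i) {i j : Λ} (hij : i ≠ j)
    (x : X i) (y : X j) (a : A i) (b : A j) :
    glueDistance κ ι (.inr ⟨i, x⟩) (.inr ⟨j, y⟩) ≤
      dist x (ι i a) + dist (κ i a) (κ j b) + dist (ι j b) y := by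
  simp only [glueDistance, dif_neg hij]
  exact ciInf_le (f := fun p : A i × A j =>
    dist x (ι i p.1) + dist (κ i p.1) (κ j p.2) + dist (ι j p.2) y)
    ⟨0, by rintro _ ⟨a, rfl⟩; positivity⟩ (a, b)

theorem exists_lt_of_glueDistance_ne_lt [∀ i, Nonempty (A i)] (κ : ∀ i, A i → X₀)
    (ι : ∀ i, A i → X i) {i j : Λ} (hij : i ≠ j) (x : X i) (y : X j) {c : ℝ}
    (h : glueDistance κ ι (.inr ⟨i, x⟩) (.inr ⟨j, y⟩) < c) :
    ∃ (a : A i) (b : A j), dist x (ι i a) + dist (κ i a) (κ j b) + dist (ι j b) y < c := by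
  simp only [glueDistance, dif_neg hij] at h
  obtain ⟨p, hp⟩ := exists_lt_of_ciInf_lt h
  exact ⟨p.1, p.2, hp⟩

variable [∀ i, MetricSpace (A i)]

theorem glueDistance_triangle [∀ i, Nonempty (A i)] {κ : ∀ i, A i → X₀} {ι : ∀ i, A i → X i}
    (hκ : ∀ i, Isometry (κ i)) (hι : ∀ i, Isometry (ι i)) (p q r : X₀ ⊕ (Σ i, X i)) :
    glueDistance κ ι p r ≤ glueDistance κ ι p q + glueDistance κ ι q r := by
  have key : ∀ i (a b : A i), dist (ι i a) (ι i b) = dist (κ i a) (κ i b) := fun i a b => by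
    rw [(hι i).dist_eq, (hκ i).dist_eq]
  refine le_of_forall_pos_le_add fun ε hε => ?_
  have hε2 : 0 < ε / 2 := by linarith
  rcases p with x | ⟨i, x⟩ <;> rcases q with y | ⟨j, y⟩ <;> rcases r with z | ⟨k, z⟩
  · have := dist_triangle x y z
    simp only [glueDistance_zero_zero]; linarith
  · obtain ⟨c, hc⟩ := exists_lt_of_glueDistance_zero_lt κ ι y k z (lt_add_of_pos_right _ hε2)
    have h1 := glueDistance_zero_le κ ι x k z c
    have h2 := dist_triangle x y (κ k c)
    rw [glueDistance_zero_zero]; linarith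
  · rw [glueDistance_comm κ ι (.inr ⟨j, y⟩), glueDistance_zero_zero]
    obtain ⟨a, ha⟩ := exists_lt_of_glueDistance_zero_lt κ ι x j y (lt_add_of_pos_right _ hε2)
    obtain ⟨b, hb⟩ := exists_lt_of_glueDistance_zero_lt κ ι z j y (lt_add_of_pos_right _ hε2)
    have h1 := dist_triangle4 x (κ j a) (κ j b) z
    have h2 := dist_triangle_right (ι j a) (ι j b) y
    rw [key] at h2
    have h3 := dist_comm z (κ j b)
    linarith
  · obtain ⟨a, ha⟩ := exists_lt_of_glueDistance_zero_lt κ ι x j y (lt_add_of_pos_right _ hε2)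
    by_cases hjk : j = k
    · subst hjk
      have h1 := glueDistance_zero_le κ ι x j z a
      have h2 := dist_triangle (ι j a) y z
      rw [glueDistance_same]; linarith
    · obtain ⟨b, c, hb⟩ := exists_lt_of_glueDistance_ne_lt κ ι hjk y z (lt_add_of_pos_right _ hε2)
      have h1 := glueDistance_zero_le κ ι x k z c
      have h2 := dist_triangle4 x (κ j a) (κ j b) (κ k c)
      have h3 := dist_triangle (ι j a) y (ι j b)
      rw [key] at h3
      linarith
  · rw [glueDistance_comm κ ι (.inr ⟨i, x⟩), glueDistance_comm κ ι (.inr ⟨i, x⟩),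
      glueDistance_zero_zero]
    obtain ⟨c, hc⟩ := exists_lt_of_glueDistance_zero_lt κ ι y i x (lt_add_of_pos_right _ hε2)
    have h1 := glueDistance_zero_le κ ι z i x c
    have h2 := dist_triangle z y (κ i c)
    have h3 := dist_comm z y
    linarith
  · rw [glueDistance_comm κ ι (.inr ⟨i, x⟩) (.inl y)]
    obtain ⟨a, ha⟩ := exists_lt_of_glueDistance_zero_lt κ ι y i x (lt_add_of_pos_right _ hε2)
    obtain ⟨b, hb⟩ := exists_lt_of_glueDistance_zero_lt κ ι y k z (lt_add_of_pos_right _ hε2)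
    by_cases hik : i = k
    · subst hik
      rw [glueDistance_same]
      have h1 := dist_triangle4 x (ι i a) (ι i b) z
      have h2 := dist_triangle_left (κ i a) (κ i b) y
      rw [← key] at h2
      have h3 := dist_comm x (ι i a)
      linarith
    · have h1 := glueDistance_ne_le κ ι hik x z a b
      have h2 := dist_triangle_left (κ i a) (κ k b) y
      have h3 := dist_comm x (ι i a)
      linarith
  · rw [glueDistance_comm κ ι (.inr ⟨i, x⟩) (.inl z), glueDistance_comm κ ι (.inr ⟨j, y⟩) (.inl z)]
    obtain ⟨b, hb⟩ := exists_lt_of_glueDistance_zero_lt κ ι z j y (lt_add_of_pos_right _ hε2)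
    by_cases hij : i = j
    · subst hij
      rw [glueDistance_same]
      have h1 := glueDistance_zero_le κ ι z i x b
      have h2 := dist_triangle_right (ι i b) x y
      linarith
    · obtain ⟨a, c, hc⟩ := exists_lt_of_glueDistance_ne_lt κ ι hij x y (lt_add_of_pos_right _ hε2)
      have h1 := glueDistance_zero_le κ ι z i x a
      have h2 := dist_triangle4 z (κ j b) (κ j c) (κ i a)
      have h3 := dist_triangle_right (ι j b) (ι j c) y
      rw [key] at h3
      have h4 := dist_comm (κ j c) (κ i a)
      have h5 := dist_comm x (ι i a)
      linarith
  · by_cases hij : i = j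
    · subst hij
      rw [glueDistance_same]
      by_cases hik : i = k
      · subst hik
        simp only [glueDistance_same]
        have := dist_triangle x y z
        linarith
      · obtain ⟨a, b, hb⟩ :=
          exists_lt_of_glueDistance_ne_lt κ ι hik y z (lt_add_of_pos_right _ hε2)
        have h1 := glueDistance_ne_le κ ι hik x z a b
        have h2 := dist_triangle x y (ι i a)
        linarith
    · obtain ⟨a, b, hb⟩ := exists_lt_of_glueDistance_ne_lt κ ι hij x y (lt_add_of_pos_right _ hε2)
      by_cases hjk : j = k
      · subst hjk
        rw [glueDistance_same]
        have h1 := glueDistance_ne_le κ ι hij x z a b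
        have h2 := dist_triangle (ι j b) y z
        linarith
      · obtain ⟨c, d, hd⟩ :=
          exists_lt_of_glueDistance_ne_lt κ ι hjk y z (lt_add_of_pos_right _ hε2)
        have h3 := dist_triangle (ι j b) y (ι j c)
        rw [key] at h3
        by_cases hik : i = k
        · subst hik
          rw [glueDistance_same]
          have h1 := dist_triangle4 x (ι i a) (ι i d) z
          rw [key] at h1
          have h2 := dist_triangle4 (κ i a) (κ j b) (κ j c) (κ i d)
          linarith
        · have h1 := glueDistance_ne_le κ ι hik x z a d
          have h2 := dist_triangle4 (κ i a) (κ j b) (κ j c) (κ k d)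
          linarith

theorem glueDistance_eq_of_rel [∀ i, Nonempty (A i)] {κ : ∀ i, A i → X₀} {ι : ∀ i, A i → X i}
    (hκ : ∀ i, Isometry (κ i)) (hι : ∀ i, Isometry (ι i)) (p : X₀ ⊕ (Σ i, X i))
    {q q' : X₀ ⊕ (Σ i, X i)} (h : GlueRel κ ι q q') :
    glueDistance κ ι p q = glueDistance κ ι p q' := by
  have h0 : glueDistance κ ι q q' ≤ 0 := by
    obtain ⟨i, a⟩ := h
    simpa using glueDistance_zero_le κ ι (κ i a) i (ι i a) a
  have h1 := glueDistance_triangle hκ hι p q q'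
  have h2 := glueDistance_triangle hκ hι p q' q
  rw [glueDistance_comm κ ι q' q] at h2
  linarith

/-- Points of the disjoint union at gluing distance zero are identified in the gluing. -/
theorem glueDistance_eq_zero [∀ i, Nonempty (A i)] {κ : ∀ i, A i → X₀} {ι : ∀ i, A i → X i}
    (hκ : ∀ i, Isometry (κ i)) (hι : ∀ i, Isometry (ι i)) (hcl : ∀ i, IsClosed (range (ι i)))
    (p q : X₀ ⊕ (Σ i, X i)) (h : glueDistance κ ι p q = 0) :
    Quot.mk (GlueRel κ ι) p = Quot.mk (GlueRel κ ι) q := by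
  have main : ∀ (x : X₀) (i : Λ) (y : X i), glueDistance κ ι (.inl x) (.inr ⟨i, y⟩) = 0 →
      Quot.mk (GlueRel κ ι) (.inl x) = Quot.mk (GlueRel κ ι) (.inr ⟨i, y⟩) := by
    intro x i y h
    have hy : y ∈ range (ι i) := by
      rw [← (hcl i).closure_eq, Metric.mem_closure_iff]
      intro ε hε
      obtain ⟨a, ha⟩ := exists_lt_of_glueDistance_zero_lt κ ι x i y (h.trans_lt hε)
      refine ⟨_, ⟨a, rfl⟩, ?_⟩
      have := dist_nonneg (x := x) (y := κ i a)
      rw [dist_comm]; linarith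
    obtain ⟨b, rfl⟩ := hy
    rw [← glueDistance_eq_of_rel hκ hι _ (GlueRel.glue i b), glueDistance_zero_zero,
      dist_eq_zero] at h
    subst h
    exact Quot.sound (GlueRel.glue i b)
  rcases p with x | ⟨i, x⟩ <;> rcases q with y | ⟨j, y⟩
  · rw [glueDistance_zero_zero, dist_eq_zero] at h
    rw [h]
  · exact main x j y h
  · rw [glueDistance_comm] at h
    exact (main y i x h).symm
  · by_cases hij : i = j
    · subst hij
      rw [glueDistance_same, dist_eq_zero] at h
      rw [h]
    · have hx : x ∈ range (ι i) := by
        rw [← (hcl i).closure_eq, Metric.mem_closure_iff]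
        intro ε hε
        obtain ⟨a, b, hab⟩ := exists_lt_of_glueDistance_ne_lt κ ι hij x y (h.trans_lt hε)
        refine ⟨_, ⟨a, rfl⟩, ?_⟩
        have h1 := dist_nonneg (x := κ i a) (y := κ j b)
        have h2 := dist_nonneg (x := ι j b) (y := y)
        linarith
      obtain ⟨a, rfl⟩ := hx
      rw [glueDistance_comm, ← glueDistance_eq_of_rel hκ hι _ (GlueRel.glue i a),
        glueDistance_comm] at h
      rw [← main (κ i a) j y h]
      exact (Quot.sound (GlueRel.glue i a)).symm

/-- The metric of the gluing, for isometric embeddings `κ i : A i → X₀` and `ι i : A i → X i` of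
nonempty spaces with closed images in the `X i`: the gluing distance of representatives. -/
noncomputable abbrev Glued.metricSpace {κ : ∀ i, A i → X₀} {ι : ∀ i, A i → X i}
    (hne : ∀ i, Nonempty (A i)) (hκ : ∀ i, Isometry (κ i)) (hι : ∀ i, Isometry (ι i))
    (hcl : ∀ i, IsClosed (range (ι i))) : MetricSpace (Glued κ ι) where
  dist := Quot.lift₂ (glueDistance κ ι)
    (fun p _ _ h => glueDistance_eq_of_rel hκ hι p h)
    (fun p q r h => by
      rw [glueDistance_comm κ ι p, glueDistance_comm κ ι q, glueDistance_eq_of_rel hκ hι r h])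
  dist_self := by rintro ⟨p⟩; exact glueDistance_self κ ι p
  dist_comm := by rintro ⟨p⟩ ⟨q⟩; exact glueDistance_comm κ ι p q
  dist_triangle := by rintro ⟨p⟩ ⟨q⟩ ⟨r⟩; exact glueDistance_triangle hκ hι p q r
  eq_of_dist_eq_zero := by rintro ⟨p⟩ ⟨q⟩ h; exact glueDistance_eq_zero hκ hι hcl p q h

end Gluing

/-! The engine is a Helly property: pairwise intersecting externally hyperconvex sets, one of them
bounded, have a common point (`sInter_nonempty`). So it suffices to find one piece of the gluing in
which the traces of all the given balls are externally hyperconvex and meet pairwise.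

Traces are controlled by gates. Seen from a point `x`, a piece `Y` has a gate `G` if `d(x, y) = τ +
d(y, G)` on `Y`, with `G` externally hyperconvex in `Y`. A nonempty trace of a ball about `x` is
then a neighbourhood of `G` and inherits external hyperconvexity. Between `X₀` and one `X_λ` the
gate is the nearest-point set in `A_λ`, as the hypotheses provide. Between two outer pieces it is
the set of points of one gluing set nearest to a gate in the other. Disjointness makes that distance
positive, and the positive scale allows a local-to-global argument (`of_locally`).

The choice of piece: if every ball reaches `X₀` and the traces there meet pairwise, `X₀` works.
Otherwise some piece `X_λ` holds either a ball that misses `X₀` or two balls whose traces in `X₀`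
are disjoint. In both cases an externally hyperconvex `M ⊆ A_λ` meets every ball centred outside
`X_λ`: the gate of the first ball, or a separator halfway between the two traces
(`exists_separator`). Then `X_λ` works: two outside balls that do not meet in `X₀` would have a
separator of their own in another gluing set, and it would meet `M`. -/

/-! ### Intersections of externally hyperconvex sets and their Helly property. -/

section ExternallyHyperconvex

variable {Z : Type*} [MetricSpace Z] {A B C Y : Set Z} {S : Set (Z × ℝ)}

/-- Every two balls of the collection satisfy `d(x, y) ≤ r + s`. -/
def BallsCompatible (S : Set (Z × ℝ)) : Prop :=
  ∀ p ∈ S, ∀ q ∈ S, dist p.1 q.1 ≤ p.2 + q.2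

theorem BallsCompatible.nonneg (h : BallsCompatible S) {p : Z × ℝ} (hp : p ∈ S) : 0 ≤ p.2 := by
  have := h p hp p hp
  rw [dist_self] at this
  linarith

theorem BallsCompatible.insert (h : BallsCompatible S) {x : Z} {r : ℝ} (hr : 0 ≤ r)
    (hx : ∀ p ∈ S, dist x p.1 ≤ r + p.2) : BallsCompatible (insert (x, r) S) := by
  rintro p (rfl | hp) q (rfl | hq)
  · simpa using hr
  · exact hx q hq
  · have := hx p hp
    rw [dist_comm]
    linarith
  · exact h p hp q hq

theorem ballsCompatible_empty : BallsCompatible (∅ : Set (Z × ℝ)) := fun _ h => h.elim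

theorem infDist_le_of_dist_le {x a : Z} {r : ℝ} (ha : a ∈ A) (h : dist a x ≤ r) :
    infDist x A ≤ r :=
  (infDist_le_dist_of_mem ha).trans (by rwa [dist_comm])

theorem infDist_le_infDist_add {x y : Z} {r : ℝ} (h : dist x y ≤ r) :
    infDist x A ≤ infDist y A + r :=
  infDist_le_infDist_add_dist.trans (by linarith)

theorem exists_dist_lt_of_infDist_lt {x : Z} {r : ℝ} (hA : A.Nonempty) (h : infDist x A < r) :
    ∃ a ∈ A, dist a x < r := by
  obtain ⟨a, ha, h⟩ := (infDist_lt_iff hA).1 h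
  exact ⟨a, ha, by rwa [dist_comm]⟩

namespace IsExternallyHyperconvexIn

theorem subset (h : IsExternallyHyperconvexIn A Y) : A ⊆ Y := h.1

theorem nonempty (h : IsExternallyHyperconvexIn A Y) : A.Nonempty := h.2.1

theorem mono (h : IsExternallyHyperconvexIn A Y) (hAB : A ⊆ B) (hB : B ⊆ Y) :
    IsExternallyHyperconvexIn A B :=
  ⟨hAB, h.2.1, fun S hS => h.2.2 S fun p hp => hB (hS p hp)⟩

theorem exists_mem (h : IsExternallyHyperconvexIn A Y) (hS : ∀ p ∈ S, p.1 ∈ Y)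
    (hc : BallsCompatible S) (hr : ∀ p ∈ S, infDist p.1 A ≤ p.2) :
    ∃ a ∈ A, ∀ p ∈ S, dist a p.1 ≤ p.2 := by
  obtain ⟨a, ha, h⟩ := h.2.2 S hS hc hr
  exact ⟨a, ha, by simpa using h⟩

theorem of_exists_mem (hAY : A ⊆ Y) (hA : A.Nonempty)
    (h : ∀ S : Set (Z × ℝ), (∀ p ∈ S, p.1 ∈ Y) → BallsCompatible S →
      (∀ p ∈ S, infDist p.1 A ≤ p.2) → ∃ a ∈ A, ∀ p ∈ S, dist a p.1 ≤ p.2) :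
    IsExternallyHyperconvexIn A Y := by
  refine ⟨hAY, hA, fun S hS hc hr => ?_⟩
  obtain ⟨a, ha, h⟩ := h S hS hc hr
  exact ⟨a, ha, by simpa using h⟩

theorem exists_mem_pair (h : IsExternallyHyperconvexIn A Y) {x y : Z} {r t : ℝ} (hx : x ∈ Y)
    (hy : y ∈ Y) (hxA : infDist x A ≤ r) (hyA : infDist y A ≤ t) (hxy : dist x y ≤ r + t) :
    ∃ a ∈ A, dist a x ≤ r ∧ dist a y ≤ t := by
  have hr := infDist_nonneg.trans hxA
  have ht := infDist_nonneg.trans hyA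
  obtain ⟨a, ha, hS⟩ := h.exists_mem (S := insert (x, r) (insert (y, t) ∅)) (by simp [hx, hy])
    ((ballsCompatible_empty.insert ht (by simp)).insert hr (by simpa using hxy))
    (by simp [hxA, hyA])
  exact ⟨a, ha, by simpa using hS⟩

theorem exists_dist_le (h : IsExternallyHyperconvexIn A Y) {x : Z} {r : ℝ} (hx : x ∈ Y)
    (hxA : infDist x A ≤ r) : ∃ a ∈ A, dist a x ≤ r := by
  have hr := infDist_nonneg.trans hxA
  obtain ⟨a, ha, h, -⟩ := h.exists_mem_pair hx hx hxA hxA (by simpa using hr)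
  exact ⟨a, ha, h⟩

theorem mem_of_infDist_le_zero (h : IsExternallyHyperconvexIn A Y) {x : Z} (hx : x ∈ Y)
    (hxA : infDist x A ≤ 0) : x ∈ A := by
  obtain ⟨a, ha, h⟩ := h.exists_dist_le hx hxA
  rwa [← dist_le_zero.1 h]

theorem singleton {x : Z} (hx : x ∈ Y) : IsExternallyHyperconvexIn {x} Y :=
  of_exists_mem (by simpa using hx) (singleton_nonempty x) fun S _ _ hr =>
    ⟨x, rfl, fun p hp => by simpa [dist_comm] using hr p hp⟩

theorem image {W : Type*} [MetricSpace W] {f : Z → W} (hf : Isometry f)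
    (h : IsExternallyHyperconvexIn A Y) : IsExternallyHyperconvexIn (f '' A) (f '' Y) := by
  refine of_exists_mem (image_mono h.subset) (h.nonempty.image f) fun S hS hc hr => ?_
  obtain ⟨a, ha, haS⟩ := h.exists_mem (S := {p | p.1 ∈ Y ∧ (f p.1, p.2) ∈ S}) (fun p hp => hp.1)
    (fun p hp q hq => by simpa [hf.dist_eq] using hc _ hp.2 _ hq.2)
    (fun p hp => by simpa [infDist_image hf] using hr _ hp.2)
  refine ⟨f a, mem_image_of_mem f ha, fun p hp => ?_⟩
  obtain ⟨y, hy, hyp⟩ := hS p hp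
  have := haS (y, p.2) ⟨hy, by simpa [hyp] using hp⟩
  rw [← hyp, hf.dist_eq]
  exact this

/-- Successive improvements, halving the excess of the distance to `B` at each step, converge. -/
theorem exists_infDist_le (h : IsExternallyHyperconvexIn A Y) (hS : ∀ p ∈ S, p.1 ∈ Y)
    (hc : BallsCompatible S) {c K t : ℝ} (hK : 0 ≤ K) (ht : 0 < t)
    (hstep : ∀ t > 0, ∀ a ∈ A, (∀ p ∈ S, dist a p.1 ≤ p.2) → infDist a B ≤ c + t →
      ∃ a' ∈ A, (∀ p ∈ S, dist a' p.1 ≤ p.2) ∧ infDist a' B ≤ c + t / 2 ∧ dist a a' ≤ K * t)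
    {a : Z} (ha : a ∈ A) (haS : ∀ p ∈ S, dist a p.1 ≤ p.2) (haB : infDist a B ≤ c + t) :
    ∃ z ∈ A, (∀ p ∈ S, dist z p.1 ≤ p.2) ∧ infDist z B ≤ c := by
  let G : ℕ → Type _ := fun n =>
    {a : Z // a ∈ A ∧ (∀ p ∈ S, dist a p.1 ≤ p.2) ∧ infDist a B ≤ c + t / 2 ^ n}
  have hnext : ∀ n (u : G n), ∃ v : G (n + 1), dist u.1 v.1 ≤ K * (t / 2 ^ n) := by
    rintro n ⟨u, hu, huS, huB⟩
    obtain ⟨v, hv, hvS, hvB, huv⟩ := hstep _ (by positivity) u hu huS huB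
    exact ⟨⟨v, hv, hvS, by rwa [pow_succ, ← div_div]⟩, huv⟩
  choose next hnext using hnext
  let s : ∀ n, G n := fun n => Nat.rec ⟨a, ha, haS, by simpa using haB⟩ next n
  have hs : ∀ n, dist (s n).1 (s (n + 1)).1 ≤ K * (t / 2 ^ n) := fun n => hnext n (s n)
  have hle : ∀ n m, n ≤ m →
      dist (s n).1 (s m).1 ≤ 2 * K * (t / 2 ^ n) - 2 * K * (t / 2 ^ m) := by
    intro n m hnm
    induction m, hnm using Nat.le_induction with
    | base => simp
    | succ m _ ih =>
      have h1 := dist_triangle (s n).1 (s m).1 (s (m + 1)).1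
      have h2 := hs m
      have h3 : t / 2 ^ (m + 1) = t / 2 ^ m / 2 := by rw [pow_succ, ← div_div]
      have h4 : 2 * K * (t / 2 ^ (m + 1)) = K * (t / 2 ^ m) := by rw [h3]; ring
      linarith
  have hpos : ∀ n : ℕ, 0 ≤ 2 * K * (t / 2 ^ n) := fun n => by positivity
  -- The radii `2 * K * (t / 2 ^ n)` are the tails of the geometric series of steps, so by `hle`
  -- these balls are compatible. External hyperconvexity supplies the limit point, in place of
  -- completeness, and keeps it in the balls of `S`.
  obtain ⟨z, hz, hzS⟩ := h.exists_mem
    (S := S ∪ range fun n => ((s n).1, 2 * K * (t / 2 ^ n)))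
    (by
      rintro p (hp | ⟨n, rfl⟩)
      · exact hS p hp
      · exact h.subset (s n).2.1)
    (by
      rintro p (hp | ⟨n, rfl⟩) q (hq | ⟨m, rfl⟩)
      · exact hc p hp q hq
      · have h1 := (s m).2.2.1 p hp
        rw [dist_comm]
        exact h1.trans (le_add_of_nonneg_right (hpos m))
      · have h1 := (s n).2.2.1 q hq
        exact h1.trans (le_add_of_nonneg_left (hpos n))
      · have h1 := hpos n
        have h2 := hpos m
        rcases le_total n m with hnm | hnm
        · have := hle n m hnm
          simp only
          linarith
        · have := hle m n hnm
          rw [dist_comm] at this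
          simp only
          linarith)
    (by
      rintro p (hp | ⟨n, rfl⟩)
      · exact infDist_le_of_dist_le ha (haS p hp)
      · exact (infDist_zero_of_mem (s n).2.1).trans_le (hpos n))
  refine ⟨z, hz, fun p hp => hzS p (Or.inl hp), ?_⟩
  have hlim : Filter.Tendsto (fun n : ℕ => c + t / 2 ^ n + 2 * K * (t / 2 ^ n)) Filter.atTop
      (nhds (c + 0 + 2 * K * 0)) := by
    have h0 : Filter.Tendsto (fun n : ℕ => t / 2 ^ n) Filter.atTop (nhds 0) := by
      have := (tendsto_pow_atTop_nhds_zero_of_lt_one (r := (1 / 2 : ℝ)) (by norm_num)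
        (by norm_num)).const_mul t
      simpa [div_eq_mul_inv] using this
    exact (tendsto_const_nhds.add h0).add (h0.const_mul _)
  rw [add_zero, mul_zero, add_zero] at hlim
  refine ge_of_tendsto' hlim fun n => ?_
  have h1 := hzS _ (Or.inr ⟨n, rfl⟩)
  exact (infDist_le_infDist_add h1).trans (by linarith [(s n).2.2.2])

/-- Inflate all radii by `n * ε` until the common point `y` lies in every ball, then remove `ε` at a
time. Each step moves `a` inside `A` and then `b` inside `B`, at most `ε` from the previous points,
so the pair stays `ε`-close and each set still reaches the balls about the other's point. -/
theorem exists_close_pair (hA : IsExternallyHyperconvexIn A Y) (hB : IsExternallyHyperconvexIn B Y)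
    {y : Z} (hy : y ∈ A ∩ B) (hS : ∀ p ∈ S, p.1 ∈ Y) (hc : BallsCompatible S)
    (hrA : ∀ p ∈ S, infDist p.1 A ≤ p.2) (hrB : ∀ p ∈ S, infDist p.1 B ≤ p.2) {ε : ℝ}
    (hε : 0 < ε) :
    ∃ a ∈ A, ∃ b ∈ B, dist a b ≤ ε ∧
      (∀ p ∈ S, dist a p.1 ≤ p.2) ∧ ∀ p ∈ S, dist b p.1 ≤ p.2 := by
  have walk : ∀ (n : ℕ) (a b : Z), a ∈ A → b ∈ B → dist a b ≤ ε →
      (∀ p ∈ S, dist a p.1 ≤ p.2 + n * ε) → (∀ p ∈ S, dist b p.1 ≤ p.2 + n * ε) →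
      ∃ a ∈ A, ∃ b ∈ B, dist a b ≤ ε ∧
        (∀ p ∈ S, dist a p.1 ≤ p.2) ∧ ∀ p ∈ S, dist b p.1 ≤ p.2 := by
    intro n
    induction n with
    | zero =>
      intro a b ha hb hab haS hbS
      exact ⟨a, ha, b, hb, hab, by simpa using haS, by simpa using hbS⟩
    | succ n ih =>
      intro a b ha hb hab haS hbS
      push_cast at haS hbS
      have hn : 0 ≤ n * ε := by positivity
      let T : Set (Z × ℝ) := (fun p => (p.1, p.2 + n * ε)) '' S
      have hTY : ∀ p ∈ T, p.1 ∈ Y := by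
        rintro _ ⟨p, hp, rfl⟩
        exact hS p hp
      have hTc : BallsCompatible T := by
        rintro _ ⟨p, hp, rfl⟩ _ ⟨q, hq, rfl⟩
        have := hc p hp q hq
        simp only
        linarith
      have hTd : ∀ {u : Z}, (∀ p ∈ S, dist u p.1 ≤ p.2 + (n + 1) * ε) →
          ∀ p ∈ T, dist u p.1 ≤ ε + p.2 := by
        rintro u hu _ ⟨p, hp, rfl⟩
        have := hu p hp
        simp only
        linarith
      have hTr : ∀ {D : Set Z}, (∀ p ∈ S, infDist p.1 D ≤ p.2) → ∀ p ∈ T, infDist p.1 D ≤ p.2 := by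
        rintro D hD _ ⟨p, hp, rfl⟩
        have := hD p hp
        simp only
        linarith
      obtain ⟨a', ha', ha'S⟩ := hA.exists_mem (S := insert (a, ε) (insert (b, ε) T))
        (by simpa [hA.subset ha, hB.subset hb] using hTY)
        ((hTc.insert hε.le (hTd hbS)).insert hε.le
          (forall_mem_insert.2 ⟨by simp only; linarith, hTd haS⟩))
        (forall_mem_insert.2 ⟨(infDist_zero_of_mem ha).trans_le hε.le,
          forall_mem_insert.2 ⟨infDist_le_of_dist_le ha hab, hTr hrA⟩⟩)
      rw [forall_mem_insert, forall_mem_insert] at ha'S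
      obtain ⟨b', hb', hb'S⟩ := hB.exists_mem (S := insert (a', ε) (insert (b, ε) T))
        (by simpa [hA.subset ha', hB.subset hb] using hTY)
        ((hTc.insert hε.le (hTd hbS)).insert hε.le
          (forall_mem_insert.2 ⟨by have := ha'S.2.1; simp only at this ⊢; linarith,
            fun p hp => (ha'S.2.2 p hp).trans (by linarith)⟩))
        (forall_mem_insert.2 ⟨infDist_le_of_dist_le hb (by rw [dist_comm]; exact ha'S.2.1),
          forall_mem_insert.2 ⟨(infDist_zero_of_mem hb).trans_le hε.le, hTr hrB⟩⟩)
      rw [forall_mem_insert, forall_mem_insert] at hb'S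
      exact ih a' b' ha' hb' (by rw [dist_comm]; exact hb'S.1)
        (fun p hp => ha'S.2.2 _ (mem_image_of_mem _ hp))
        (fun p hp => hb'S.2.2 _ (mem_image_of_mem _ hp))
  rcases S.eq_empty_or_nonempty with rfl | ⟨p₀, hp₀⟩
  · exact ⟨y, hy.1, y, hy.2, by simpa using hε.le, by simp, by simp⟩
  · obtain ⟨n, hn⟩ := exists_nat_ge ((p₀.2 + dist p₀.1 y) / ε)
    rw [div_le_iff₀ hε] at hn
    have hyS : ∀ p ∈ S, dist y p.1 ≤ p.2 + n * ε := fun p hp => by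
      have h1 := dist_triangle p.1 p₀.1 y
      have h2 := hc p hp p₀ hp₀
      rw [dist_comm]
      linarith
    exact walk n y y hy.1 hy.2 (by simpa using hε.le) hyS hyS

theorem exists_mem_inter (hA : IsExternallyHyperconvexIn A Y) (hB : IsExternallyHyperconvexIn B Y)
    (hAB : (A ∩ B).Nonempty) (hS : ∀ p ∈ S, p.1 ∈ Y) (hc : BallsCompatible S)
    (hrA : ∀ p ∈ S, infDist p.1 A ≤ p.2) (hrB : ∀ p ∈ S, infDist p.1 B ≤ p.2) :
    ∃ z ∈ A ∩ B, ∀ p ∈ S, dist z p.1 ≤ p.2 := by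
  obtain ⟨y, hy⟩ := hAB
  obtain ⟨a, ha, b, hb, hab, haS, -⟩ := exists_close_pair hA hB hy hS hc hrA hrB one_pos
  have hstep : ∀ t > 0, ∀ a ∈ A, (∀ p ∈ S, dist a p.1 ≤ p.2) → infDist a B ≤ 0 + t →
      ∃ a' ∈ A, (∀ p ∈ S, dist a' p.1 ≤ p.2) ∧ infDist a' B ≤ 0 + t / 2 ∧ dist a a' ≤ 1 * t := by
    -- Adding the ball `(a, t)` to `S` keeps the new point within `t` of `a`, while closeness `t /
    -- 2` halves the distance to `B`.
    intro t ht a ha haS haB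
    rw [zero_add] at haB
    obtain ⟨a', ha', b', hb', hab', ha'S, -⟩ :=
      exists_close_pair (S := insert (a, t) S) (ε := t / 2) hA hB hy
      (forall_mem_insert.2 ⟨hA.subset ha, hS⟩)
      (hc.insert ht.le fun p hp => (haS p hp).trans (by linarith))
      (forall_mem_insert.2 ⟨(infDist_zero_of_mem ha).trans_le ht.le, hrA⟩)
      (forall_mem_insert.2 ⟨haB, hrB⟩) (by linarith)
    rw [forall_mem_insert] at ha'S
    exact ⟨a', ha', ha'S.2, infDist_le_of_dist_le hb' (by rw [dist_comm]; linarith),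
      by rw [dist_comm]; linarith [ha'S.1]⟩
  obtain ⟨z, hz, hzS, hzB⟩ := hA.exists_infDist_le hS hc zero_le_one one_pos hstep ha haS
    (infDist_le_of_dist_le hb (by rw [dist_comm]; linarith))
  exact ⟨z, ⟨hz, hB.mem_of_infDist_le_zero (hA.subset hz) hzB⟩, hzS⟩

theorem inter (hA : IsExternallyHyperconvexIn A Y) (hB : IsExternallyHyperconvexIn B Y)
    (hAB : (A ∩ B).Nonempty) : IsExternallyHyperconvexIn (A ∩ B) Y :=
  of_exists_mem (inter_subset_left.trans hA.subset) hAB fun _ hS hc hr =>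
    exists_mem_inter hA hB hAB hS hc
      (fun p hp => (infDist_le_infDist_of_subset inter_subset_left hAB).trans (hr p hp))
      (fun p hp => (infDist_le_infDist_of_subset inter_subset_right hAB).trans (hr p hp))

theorem exists_mem_inter_of_infDist_le (hA : IsExternallyHyperconvexIn A Y)
    (hB : IsExternallyHyperconvexIn B Y) (hAB : (A ∩ B).Nonempty) {x : Z} {r : ℝ} (hx : x ∈ Y)
    (hxA : infDist x A ≤ r) (hxB : infDist x B ≤ r) : ∃ z ∈ A ∩ B, dist z x ≤ r := by
  obtain ⟨z, hz, h⟩ := exists_mem_inter hA hB hAB (S := insert (x, r) ∅) (by simpa using hx)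
    (ballsCompatible_empty.insert (infDist_nonneg.trans hxA) (by simp)) (by simpa using hxA)
    (by simpa using hxB)
  exact ⟨z, hz, by simpa using h⟩

/-- Three pairwise intersecting externally hyperconvex sets have a common point. -/
theorem inter_inter_nonempty (hA : IsExternallyHyperconvexIn A Y)
    (hB : IsExternallyHyperconvexIn B Y) (hC : IsExternallyHyperconvexIn C Y)
    (hAB : (A ∩ B).Nonempty) (hAC : (A ∩ C).Nonempty) (hBC : (B ∩ C).Nonempty) :
    (A ∩ B ∩ C).Nonempty := by
  obtain ⟨x, hx⟩ := hAB
  have hAB : (A ∩ B).Nonempty := ⟨x, hx⟩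
  have hD := hA.inter hB hAB
  have hstep : ∀ t > 0, ∀ x ∈ A ∩ B, (∀ p ∈ (∅ : Set (Z × ℝ)), dist x p.1 ≤ p.2) →
      infDist x C ≤ 0 + t → ∃ x' ∈ A ∩ B, (∀ p ∈ (∅ : Set (Z × ℝ)), dist x' p.1 ≤ p.2) ∧
        infDist x' C ≤ 0 + t / 2 ∧ dist x x' ≤ 2 * t := by
    rintro t ht x ⟨hxA, hxB⟩ - hxC
    rw [zero_add] at hxC
    have hxY := hA.subset hxA
    -- From `x`, find `p ∈ A ∩ C` and `q ∈ B ∩ C` with `x, p, q` pairwise within `t`. A point `c ∈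
    -- C` halfway between `p` and `q` is within `t / 2` of both `A` and `B`, hence of some `x' ∈ A ∩
    -- B`. The displacement is at most `t + t / 2 + t / 2`.
    obtain ⟨p, ⟨hpA, hpC⟩, hpx⟩ := exists_mem_inter_of_infDist_le hA hC hAC hxY
      ((infDist_zero_of_mem hxA).trans_le ht.le) hxC
    obtain ⟨q, ⟨hqB, hqC⟩, hq⟩ := exists_mem_inter hB hC hBC
      (S := insert (x, t) (insert (p, t) ∅)) (by simpa using ⟨hxY, hA.subset hpA⟩)
      ((ballsCompatible_empty.insert ht.le (by simp)).insert ht.le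
        (by simp; rw [dist_comm]; linarith))
      (by simpa using ⟨(infDist_zero_of_mem hxB).trans_le ht.le,
        infDist_le_of_dist_le hxB (by rwa [dist_comm])⟩)
      (by simpa using ⟨hxC, (infDist_zero_of_mem hpC).trans_le ht.le⟩)
    simp only [forall_mem_insert, mem_empty_iff_false, false_imp_iff, implies_true, and_true] at hq
    obtain ⟨c, hcC, hcp, hcq⟩ := hC.exists_mem_pair (r := t / 2) (t := t / 2) (hC.subset hpC)
      (hC.subset hqC) ((infDist_zero_of_mem hpC).trans_le (by linarith))
      ((infDist_zero_of_mem hqC).trans_le (by linarith)) (by rw [dist_comm]; linarith [hq.2])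
    obtain ⟨x', hx', hx'c⟩ := exists_mem_inter_of_infDist_le hA hB hAB (r := t / 2)
      (hC.subset hcC) (infDist_le_of_dist_le hpA (by rwa [dist_comm]))
      (infDist_le_of_dist_le hqB (by rwa [dist_comm]))
    refine ⟨x', hx', by simp, ?_, ?_⟩
    · rw [zero_add]
      exact infDist_le_of_dist_le hcC (by rwa [dist_comm])
    · have h1 := dist_triangle4 x p c x'
      rw [dist_comm x p, dist_comm p c, dist_comm c x'] at h1
      linarith
  obtain ⟨z, hz, -, hzC⟩ := hD.exists_infDist_le (t := infDist x C + 1) (by simp)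
    ballsCompatible_empty zero_le_two (by linarith [infDist_nonneg (x := x) (s := C)]) hstep hx
    (by simp) (by linarith)
  exact ⟨z, hz, hC.mem_of_infDist_le_zero (hD.subset hz) hzC⟩

/-- There is a minimal function `f` such that every member of the family meets all the balls
`B(x, f x)` in a common point. -/
theorem exists_minimal_radius {D : Set (Set Z)}
    (hD : ∀ C ∈ D, IsExternallyHyperconvexIn C Y)
    (hdir : ∀ C ∈ D, ∀ C' ∈ D, ∃ C'' ∈ D, C'' ⊆ C ∩ C') {C₀ : Set Z} (hC₀ : C₀ ∈ D)
    (hb : Bornology.IsBounded C₀) :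
    ∃ f : Y → ℝ, (∀ C ∈ D, ∃ p ∈ C, ∀ x : Y, dist p x ≤ f x) ∧
      ∀ g : Y → ℝ, (∀ C ∈ D, ∃ p ∈ C, ∀ x : Y, dist p x ≤ g x) → (∀ x, g x ≤ f x) →
        ∀ x, f x ≤ g x := by
  obtain ⟨R, hR⟩ := isBounded_iff.1 hb
  obtain ⟨c₀, hc₀⟩ := (hD C₀ hC₀).nonempty
  let F : Set (Y → ℝ)ᵒᵈ := {f | ∀ C ∈ D, ∃ p ∈ C, ∀ x : Y, dist p x ≤ OrderDual.ofDual f x}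
  have hF₀ : OrderDual.toDual (fun x : Y => R + dist c₀ x) ∈ F := fun C hC => by
    obtain ⟨C', hC', hsub⟩ := hdir C hC C₀ hC₀
    obtain ⟨p, hp⟩ := (hD C' hC').nonempty
    refine ⟨p, (hsub hp).1, fun x => ?_⟩
    have h1 := dist_triangle p c₀ x
    have h2 := hR (hsub hp).2 hc₀
    simp only [OrderDual.ofDual_toDual]
    linarith
  obtain ⟨f, -, hf⟩ := zorn_le_nonempty₀ F (by
    intro c hcF hchain g₀ hg₀
    have hnonneg : ∀ g ∈ c, ∀ x : Y, 0 ≤ OrderDual.ofDual g x := fun g hg x => by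
      obtain ⟨p, -, hp⟩ := hcF hg C₀ hC₀
      exact dist_nonneg.trans (hp x)
    have hbdd : ∀ x : Y, BddBelow (range fun g : c => OrderDual.ofDual g.1 x) := fun x =>
      ⟨0, by rintro _ ⟨g, rfl⟩; exact hnonneg g.1 g.2 x⟩
    have : Nonempty c := ⟨⟨g₀, hg₀⟩⟩
    refine ⟨OrderDual.toDual fun x => ⨅ g : c, OrderDual.ofDual g.1 x, fun C hC => ?_,
      fun g hg x => ciInf_le (hbdd x) ⟨g, hg⟩⟩
    -- Members of the chain are comparable, so a point that witnesses the smaller function also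
    -- witnesses the larger one. This makes the balls of all members compatible at once, and a
    -- common point witnesses the infimum.
    have hle : ∀ g ∈ c, ∀ h ∈ c, (∀ x, OrderDual.ofDual g x ≤ OrderDual.ofDual h x) →
        ∀ x y : Y, dist (x : Z) y ≤ OrderDual.ofDual g x + OrderDual.ofDual h y := by
      intro g hg h _ hgh x y
      obtain ⟨p, -, hp⟩ := hcF hg C hC
      have := dist_triangle_left (x : Z) y p
      linarith [hp x, hp y, hgh y]
    obtain ⟨p, hpC, hp⟩ := (hD C hC).exists_mem
      (S := {q | ∃ g ∈ c, ∃ x : Y, q = ((x : Z), OrderDual.ofDual g x)})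
      (by rintro _ ⟨g, hg, x, rfl⟩; exact x.2)
      (by
        rintro _ ⟨g, hg, x, rfl⟩ _ ⟨h, hh, y, rfl⟩
        rcases hchain.total hg hh with hgh | hgh
        · have := hle h hh g hg hgh y x
          rw [dist_comm]
          simp only
          linarith
        · exact hle g hg h hh hgh x y)
      (by
        rintro _ ⟨g, hg, x, rfl⟩
        obtain ⟨p, hp, h⟩ := hcF hg C hC
        exact infDist_le_of_dist_le hp (h x))
    exact ⟨p, hpC, fun x => le_ciInf fun g => hp _ ⟨g.1, g.2, x, rfl⟩⟩) _ hF₀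
  exact ⟨OrderDual.ofDual f, hf.1, fun g hg h => hf.2 (y := OrderDual.toDual g) hg h⟩

/-- A downward directed family of externally hyperconvex sets, one of them bounded, has a common
point. -/
theorem sInter_nonempty_of_directed {D : Set (Set Z)}
    (hD : ∀ C ∈ D, IsExternallyHyperconvexIn C Y)
    (hdir : ∀ C ∈ D, ∀ C' ∈ D, ∃ C'' ∈ D, C'' ⊆ C ∩ C') {C₀ : Set Z} (hC₀ : C₀ ∈ D)
    (hb : Bornology.IsBounded C₀) : (⋂₀ D).Nonempty := by
  classical
  obtain ⟨f, hfD, hmin⟩ := exists_minimal_radius hD hdir hC₀ hb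
  obtain ⟨R, hR⟩ := isBounded_iff.1 hb
  let M : Set Z → Set Y := fun C => {p | (p : Z) ∈ C ∧ ∀ x : Y, dist (p : Z) x ≤ f x}
  have hM : ∀ C ∈ D, (M C).Nonempty := fun C hC => by
    obtain ⟨p, hp, h⟩ := hfD C hC
    exact ⟨⟨p, (hD C hC).subset hp⟩, hp, h⟩
  -- Lowering `f` at the single point `x` to `min (f x) r` keeps it admissible, by directedness, so
  -- minimality forbids a strict decrease.
  have hcover : ∀ C ∈ D, ∀ (x : Y) (r : ℝ), (∀ a ∈ M C, dist (a : Z) x ≤ r) → f x ≤ r := by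
    intro C hC x r hr
    have := hmin (Function.update f x (min (f x) r)) (fun C' hC' => ?_) (fun y => ?_) x
    · simpa using this
    · obtain ⟨C'', hC'', hsub⟩ := hdir C hC C' hC'
      obtain ⟨p, hp, hpf⟩ := hM C'' hC''
      refine ⟨p, (hsub hp).2, fun y => ?_⟩
      rcases eq_or_ne y x with rfl | hy
      · simpa using ⟨hpf y, hr p ⟨(hsub hp).1, hpf⟩⟩
      · simpa [hy] using hpf y
    · rcases eq_or_ne y x with rfl | hy
      · simp
      · simp [hy]
  have hbdd : BddAbove (f '' M C₀) := by
    refine ⟨R, ?_⟩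
    rintro _ ⟨x, hx, rfl⟩
    exact hcover C₀ hC₀ x R fun a ha => hR ha.1 hx.1
  set δ := sSup (f '' M C₀)
  have hle : ∀ a ∈ M C₀, f a ≤ δ := fun a ha => le_csSup hbdd (mem_image_of_mem f ha)
  have hδ0 : 0 ≤ δ := by
    obtain ⟨a, ha⟩ := hM C₀ hC₀
    exact (dist_nonneg.trans (ha.2 a)).trans (hle a ha)
  -- Points of `M C'` are pairwise within `δ`, so balls of radius `δ / 2` about them have a common
  -- point in `M C'`. Lowering `f` to `δ / 2` on `M C₀` is then admissible, with these centres as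
  -- witnesses, which forces `δ = 0`.
  have hcentre : ∀ C ∈ D, ∃ p ∈ M C, f p ≤ δ / 2 := by
    intro C hC
    obtain ⟨C', hC', hsub⟩ := hdir C hC C₀ hC₀
    have hsubM : M C' ⊆ M C₀ := fun a ha => ⟨(hsub ha.1).2, ha.2⟩
    obtain ⟨p, hp, hpS⟩ := (hD C' hC').exists_mem
      (S := (fun a : Y => ((a : Z), δ / 2)) '' M C' ∪ range fun x : Y => ((x : Z), f x))
      (by rintro _ (⟨a, -, rfl⟩ | ⟨x, rfl⟩) <;> exact Subtype.prop _)
      (by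
        rintro _ (⟨a, ha, rfl⟩ | ⟨x, rfl⟩) _ (⟨b, hb, rfl⟩ | ⟨y, rfl⟩)
        · have h1 := ha.2 b
          have h2 := hle b (hsubM hb)
          simp only
          linarith
        · have h1 := ha.2 y
          simp only
          linarith
        · have h1 := hb.2 x
          rw [dist_comm]
          simp only
          linarith
        · obtain ⟨p, -, hp⟩ := hfD C' hC'
          have := dist_triangle_left (x : Z) y p
          simp only
          linarith [hp x, hp y])
      (by
        rintro _ (⟨a, ha, rfl⟩ | ⟨x, rfl⟩)
        · exact (infDist_zero_of_mem ha.1).trans_le (by positivity)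
        · obtain ⟨p, hp, h⟩ := hfD C' hC'
          exact infDist_le_of_dist_le hp (h x))
    refine ⟨⟨p, (hD C' hC').subset hp⟩, ⟨(hsub hp).1, fun x => hpS _ (Or.inr ⟨x, rfl⟩)⟩, ?_⟩
    refine hcover C' hC' _ _ fun a ha => ?_
    rw [dist_comm]
    exact hpS _ (Or.inl ⟨a, ha, rfl⟩)
  have hhalf : ∀ a ∈ M C₀, f a ≤ δ / 2 := by
    intro a ha
    have := hmin (fun x => if x ∈ M C₀ then min (f x) (δ / 2) else f x) (fun C hC => ?_)
      (fun x => ?_) a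
    · rw [if_pos ha] at this
      exact this.trans (min_le_right _ _)
    · obtain ⟨p, hp, hpδ⟩ := hcentre C hC
      refine ⟨p, hp.1, fun x => ?_⟩
      split_ifs with hx
      · refine le_min (hp.2 x) ?_
        rw [dist_comm]
        exact (hx.2 p).trans hpδ
      · exact hp.2 x
    · split_ifs
      · exact min_le_left _ _
      · exact le_rfl
  have hδ' : δ ≤ δ / 2 := csSup_le ((hM C₀ hC₀).image f) (by rintro _ ⟨a, ha, rfl⟩; exact hhalf a ha)
  obtain ⟨p, hp⟩ := hM C₀ hC₀
  refine ⟨p, fun C hC => ?_⟩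
  obtain ⟨C', hC', hsub⟩ := hdir C hC C₀ hC₀
  obtain ⟨q, hq⟩ := hM C' hC'
  have h1 : dist (q : Z) p ≤ 0 := (hq.2 p).trans ((hle p hp).trans (by linarith))
  rw [← dist_le_zero.1 h1]
  exact (hsub hq.1).1

/-- Pairwise intersecting externally hyperconvex sets, one of them bounded, have a common point. -/
theorem sInter_nonempty {D : Set (Set Z)} (hD : ∀ C ∈ D, IsExternallyHyperconvexIn C Y)
    (hpair : ∀ C ∈ D, ∀ C' ∈ D, (C ∩ C').Nonempty) {C₀ : Set Z} (hC₀ : C₀ ∈ D)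
    (hb : Bornology.IsBounded C₀) : (⋂₀ D).Nonempty := by
  -- The three-set lemma is what lets the induction run: an intersection already formed, a new
  -- member and any further member meet pairwise, hence jointly.
  have hfin : ∀ F : Set (Set Z), F.Finite → F ⊆ D →
      IsExternallyHyperconvexIn (C₀ ∩ ⋂₀ F) Y ∧ ∀ C ∈ D, (C₀ ∩ ⋂₀ F ∩ C).Nonempty := by
    intro F hF
    induction F, hF using Set.Finite.induction_on with
    | empty => exact fun _ => ⟨by simpa using hD C₀ hC₀, by simpa using hpair C₀ hC₀⟩
    | @insert C F _ _ ih =>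
      intro hsub
      rw [insert_subset_iff] at hsub
      obtain ⟨h1, h2⟩ := ih hsub.2
      have heq : C₀ ∩ ⋂₀ insert C F = C₀ ∩ ⋂₀ F ∩ C := by
        rw [sInter_insert, inter_assoc, inter_comm C]
      rw [heq]
      exact ⟨h1.inter (hD C hsub.1) (h2 C hsub.1), fun C' hC' =>
        inter_inter_nonempty h1 (hD C hsub.1) (hD C' hC') (h2 C hsub.1) (h2 C' hC')
          (hpair C hsub.1 C' hC')⟩
  obtain ⟨z, hz⟩ := sInter_nonempty_of_directed
    (D := {C | ∃ F : Set (Set Z), F.Finite ∧ F ⊆ D ∧ C = C₀ ∩ ⋂₀ F}) (Y := Y) (C₀ := C₀)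
    (by rintro _ ⟨F, hF, hFD, rfl⟩; exact (hfin F hF hFD).1)
    (by
      rintro _ ⟨F, hF, hFD, rfl⟩ _ ⟨G, hG, hGD, rfl⟩
      refine ⟨_, ⟨F ∪ G, hF.union hG, union_subset hFD hGD, rfl⟩, ?_⟩
      rw [sInter_union]
      exact fun x hx => ⟨⟨hx.1, hx.2.1⟩, hx.1, hx.2.2⟩)
    ⟨∅, finite_empty, empty_subset D, by simp⟩ hb
  refine ⟨z, fun C hC => ?_⟩
  have := hz _ ⟨{C}, finite_singleton C, by simpa using hC, rfl⟩
  simpa using this.2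

end IsExternallyHyperconvexIn

end ExternallyHyperconvex

/-! ### Weakly externally hyperconvex sets and their distance to externally hyperconvex sets. -/

section ExternallyHyperconvex

variable {Z : Type*} [MetricSpace Z] {A B C E M Y : Set Z} {S : Set (Z × ℝ)}

/-- The subspace `Y` is hyperconvex. -/
def HyperconvexOn (Y : Set Z) : Prop :=
  ∀ S : Set (Z × ℝ), (∀ p ∈ S, p.1 ∈ Y) → BallsCompatible S → ∃ z ∈ Y, ∀ p ∈ S, dist z p.1 ≤ p.2

theorem HyperconvexOn.exists_pair (h : HyperconvexOn Y) {x y : Z} {r t : ℝ} (hx : x ∈ Y)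
    (hy : y ∈ Y) (hr : 0 ≤ r) (ht : 0 ≤ t) (hxy : dist x y ≤ r + t) :
    ∃ z ∈ Y, dist z x ≤ r ∧ dist z y ≤ t := by
  obtain ⟨a, ha, hS⟩ := h (insert (x, r) (insert (y, t) ∅)) (by simp [hx, hy])
    ((ballsCompatible_empty.insert ht (by simp)).insert hr (by simpa using hxy))
  exact ⟨a, ha, by simpa using hS⟩

/-- `A` is weakly externally hyperconvex in the subspace `Y`. -/
def WeaklyExternallyHyperconvexIn (A Y : Set Z) : Prop :=
  A ⊆ Y ∧ ∀ x ∈ Y, IsExternallyHyperconvexIn A (A ∪ {x})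

namespace WeaklyExternallyHyperconvexIn

theorem exists_mem (h : WeaklyExternallyHyperconvexIn A Y) {x a b : Z} {r s t : ℝ} (hx : x ∈ Y)
    (hxA : infDist x A ≤ r) (ha : a ∈ A) (hb : b ∈ A) (hs : 0 ≤ s) (ht : 0 ≤ t)
    (hxa : dist x a ≤ r + s) (hxb : dist x b ≤ r + t) (hab : dist a b ≤ s + t) :
    ∃ c ∈ A, dist c x ≤ r ∧ dist c a ≤ s ∧ dist c b ≤ t := by
  have hr := infDist_nonneg.trans hxA
  obtain ⟨c, hc, hS⟩ := (h.2 x hx).exists_mem (S := insert (x, r) (insert (a, s) (insert (b, t) ∅)))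
    (by simp [ha, hb])
    (((ballsCompatible_empty.insert ht (by simp)).insert hs (by simpa using hab)).insert hr
      (by simpa using ⟨hxa, hxb⟩))
    (by simpa [infDist_zero_of_mem ha, infDist_zero_of_mem hb] using ⟨hxA, hs, ht⟩)
  exact ⟨c, hc, by simpa using hS⟩

/-- Walk from `a₀` towards `a` in steps of length `2 * t`: go to a point `e ∈ E` within `t`, then
back to a point of `A` within `t` of `e`. No step leaves the `t`-neighbourhood of `E`, and the walk
can continue until `a` is within `σ`. Hence the points of `A` near `E` satisfy a betweenness
property, and an excess distance `δ` to `E` can be removed by a move of length `δ`. -/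
theorem exists_mem_near (h : WeaklyExternallyHyperconvexIn A Y)
    (hE : IsExternallyHyperconvexIn E Y) {t δ : ℝ} (ht : 0 < t) (hδ : 0 ≤ δ) {a₀ a : Z}
    (ha₀ : a₀ ∈ A) (ha : a ∈ A) (ha₀E : infDist a₀ E ≤ t) (haE : infDist a E ≤ t + δ) {ρ σ : ℝ}
    (hρ : 0 ≤ ρ) (hσ : δ ≤ σ) (hd : dist a₀ a ≤ ρ + σ) :
    ∃ c ∈ A, infDist c E ≤ t ∧ dist c a₀ ≤ ρ ∧ dist c a ≤ σ := by
  obtain ⟨n, hn⟩ := exists_nat_ge (ρ / (2 * t))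
  rw [div_le_iff₀ (by positivity)] at hn
  induction n generalizing a₀ ρ with
  | zero =>
    refine ⟨a₀, ha₀, ha₀E, by simpa using hρ, ?_⟩
    push_cast at hn
    linarith
  | succ n ih =>
    push_cast at hn
    rcases le_or_gt (dist a₀ a) σ with h0 | h0
    · exact ⟨a₀, ha₀, ha₀E, by simpa using hρ, h0⟩
    obtain ⟨e, he, hea₀, hea⟩ := hE.exists_mem_pair (t := max (dist a₀ a - t) (t + δ))
      (h.1 ha₀) (h.1 ha) ha₀E (haE.trans (le_max_right _ _))
      (by linarith [le_max_left (dist a₀ a - t) (t + δ)])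
    rcases le_or_gt ρ (2 * t) with hρt | hρt
    · obtain ⟨c, hc, hce, hca₀, hca⟩ := h.exists_mem (r := t) (hE.subset he)
        (infDist_le_of_dist_le ha₀ (by rwa [dist_comm])) ha₀ ha hρ (hδ.trans hσ) (by linarith)
        (hea.trans (max_le (by linarith) (by linarith))) hd
      exact ⟨c, hc, infDist_le_of_dist_le he (by rwa [dist_comm]), hca₀, hca⟩
    · obtain ⟨c, hc, hce, hca₀, hca⟩ := h.exists_mem (r := t) (s := 2 * t)
        (t := max (dist a₀ a - 2 * t) σ) (hE.subset he)
        (infDist_le_of_dist_le ha₀ (by rwa [dist_comm])) ha₀ ha (by positivity)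
        ((hδ.trans hσ).trans (le_max_right _ _)) (by linarith)
        (hea.trans (max_le (by linarith [le_max_left (dist a₀ a - 2 * t) σ])
          (by linarith [le_max_right (dist a₀ a - 2 * t) σ])))
        (by linarith [le_max_left (dist a₀ a - 2 * t) σ])
      obtain ⟨b, hb, hbE, hbc, hba⟩ := ih (ρ := ρ - 2 * t) hc
        (infDist_le_of_dist_le he (by rwa [dist_comm])) (by linarith)
        (hca.trans (max_le (by linarith) (by linarith))) (by linarith)
      refine ⟨b, hb, hbE, ?_, hba⟩
      have := dist_triangle b c a₀
      linarith

/-- The distance between a weakly externally hyperconvex and an externally hyperconvex set is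
attained. -/
theorem exists_infDist_le (h : WeaklyExternallyHyperconvexIn A Y)
    (hE : IsExternallyHyperconvexIn E Y) {c : ℝ} (hc : 0 ≤ c)
    (hcE : ∀ ε > 0, ∃ a ∈ A, infDist a E ≤ c + ε) : ∃ a ∈ A, infDist a E ≤ c := by
  obtain ⟨a, ha, haE⟩ := hcE 1 one_pos
  have hA : IsExternallyHyperconvexIn A A :=
    (h.2 a (h.1 ha)).mono subset_rfl subset_union_left
  have hstep : ∀ t > 0, ∀ a ∈ A, (∀ p ∈ (∅ : Set (Z × ℝ)), dist a p.1 ≤ p.2) →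
      infDist a E ≤ c + t → ∃ a' ∈ A, (∀ p ∈ (∅ : Set (Z × ℝ)), dist a' p.1 ≤ p.2) ∧
        infDist a' E ≤ c + t / 2 ∧ dist a a' ≤ 1 * t := by
    intro t ht a ha _ haE
    -- The better point `a₀` may be far from `a`; `exists_mem_near` replaces it by one within `t` of
    -- `a`.
    obtain ⟨a₀, ha₀, ha₀E⟩ := hcE (t / 2) (by positivity)
    obtain ⟨b, hb, hbE, -, hba⟩ := h.exists_mem_near hE (t := c + t / 2) (δ := t / 2) (σ := t)
      (by positivity) (by positivity) ha₀ ha ha₀E (by linarith) dist_nonneg (by linarith)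
      (le_add_of_nonneg_right ht.le)
    exact ⟨b, hb, by simp, hbE, by rwa [one_mul, dist_comm]⟩
  obtain ⟨z, hz, -, hzE⟩ := hA.exists_infDist_le (by simp) ballsCompatible_empty zero_le_one one_pos
    hstep ha (by simp) haE
  exact ⟨z, hz, hzE⟩

end WeaklyExternallyHyperconvexIn

theorem IsExternallyHyperconvexIn.weakly (h : IsExternallyHyperconvexIn A Y) :
    WeaklyExternallyHyperconvexIn A Y :=
  ⟨h.subset, fun _ hx => h.mono subset_union_left
    (union_subset h.subset (singleton_subset_iff.2 hx))⟩

/-! ### From local to global external hyperconvexity. -/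

section LocalToGlobal

variable {s : ℝ} (hMY : M ⊆ Y)
  (hbetween : ∀ a ∈ M, ∀ b ∈ M, ∀ ρ σ : ℝ, 0 ≤ ρ → 0 ≤ σ → dist a b ≤ ρ + σ →
    ∃ c ∈ M, dist c a ≤ ρ ∧ dist c b ≤ σ)
  (hlocal : ∀ T ⊆ M, (∀ a ∈ T, ∀ b ∈ T, dist a b ≤ 2 * s) →
    ∃ E ⊆ M, T ⊆ E ∧ IsExternallyHyperconvexIn E Y)

include hMY hbetween hlocal

/-- Slide along `M` towards `y` without leaving the ball about `x`. A point `c` one step of `2 * s`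
closer to `y` shares with `a` an externally hyperconvex set, which reaches both the ball about `x`
and the shrunken ball about `y`. -/
theorem exists_mem_of_locally (hs : 0 < s) {x a y : Z} {r ρ : ℝ} (hx : x ∈ Y) (ha : a ∈ M)
    (hy : y ∈ M) (hρ : 0 ≤ ρ) (hax : dist a x ≤ r) (hxy : dist x y ≤ r + ρ) :
    ∃ b ∈ M, dist b x ≤ r ∧ dist b y ≤ ρ := by
  obtain ⟨n, hn⟩ := exists_nat_ge (dist a y / (2 * s))
  rw [div_le_iff₀ (by positivity)] at hn
  induction n generalizing a with
  | zero => exact ⟨a, ha, hax, hn.trans (by simpa using hρ)⟩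
  | succ n ih =>
    push_cast at hn
    obtain ⟨c, hc, hca, hcy⟩ := hbetween a ha y hy (2 * s) (n * (2 * s)) (by positivity)
      (by positivity) (by linarith)
    obtain ⟨E, hEM, hE, hEY⟩ := hlocal {a, c} (by simp [insert_subset_iff, ha, hc])
      (by simp [dist_comm a c, hca, hs.le])
    obtain ⟨b, hb, hbx, hby⟩ := hEY.exists_mem_pair (t := max ρ (n * (2 * s))) hx (hMY hy)
      (infDist_le_of_dist_le (hE (mem_insert a _)) hax)
      (infDist_le_of_dist_le (hE (by simp : c ∈ _)) (hcy.trans (le_max_right _ _)))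
      (hxy.trans (by linarith [le_max_left ρ (n * (2 * s))]))
    rcases le_total (n * (2 * s)) ρ with h | h
    · exact ⟨b, hEM hb, hbx, by rwa [max_eq_left h] at hby⟩
    · exact ih (hEM hb) hbx (by rwa [max_eq_right h] at hby)

/-- A set that is locally externally hyperconvex at a uniform scale is externally hyperconvex. -/
theorem IsExternallyHyperconvexIn.of_locally (hs : 0 < s) (hM : M.Nonempty) :
    IsExternallyHyperconvexIn M Y := by
  have hprox : ∀ (x : Z) (r : ℝ), x ∈ Y → infDist x M ≤ r → ∃ a ∈ M, dist a x ≤ r := by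
    intro x r hx hr
    obtain ⟨a₀, ha₀, ha₀x⟩ := exists_dist_lt_of_infDist_lt hM
      (hr.trans_lt (lt_add_of_pos_right r hs))
    obtain ⟨E, hEM, hE, hEY⟩ := hlocal (M ∩ closedBall a₀ s) inter_subset_left (by
      rintro a ⟨-, ha⟩ b ⟨-, hb⟩
      rw [mem_closedBall] at ha hb
      linarith [dist_triangle_right a b a₀])
    obtain ⟨a, ha, hax⟩ := hEY.exists_dist_le (r := r) hx (by
      refine le_of_forall_pos_le_add fun ε hε => ?_
      obtain ⟨a, ha, hax⟩ := exists_dist_lt_of_infDist_lt hM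
        (hr.trans_lt (lt_add_of_pos_right r hε))
      obtain ⟨b, hb, hbx, hba⟩ := exists_mem_of_locally hMY hbetween hlocal hs (ρ := s) hx ha ha₀
        hs.le hax.le (by rw [dist_comm]; linarith)
      exact infDist_le_of_dist_le (hE ⟨hb, hba⟩) hbx)
    exact ⟨a, hEM ha, hax⟩
  refine of_exists_mem hMY hM fun S hS hc hr => ?_
  -- One local set `E` contains all points of `M` within `s` of `b`. By sliding, every ball with its
  -- excess reduced by `s` still reaches `E`.
  have hshrink : ∀ (n : ℕ) (b : Z), b ∈ M → (∀ p ∈ S, dist b p.1 ≤ p.2 + n * s) →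
      ∃ a ∈ M, ∀ p ∈ S, dist a p.1 ≤ p.2 := by
    intro n
    induction n with
    | zero => exact fun b hb hbS => ⟨b, hb, by simpa using hbS⟩
    | succ n ih =>
      intro b hb hbS
      have hn : 0 ≤ n * s := by positivity
      push_cast at hbS
      obtain ⟨E, hEM, hE, hEY⟩ := hlocal
        {c | c ∈ M ∧ dist c b ≤ s} (fun c hc => hc.1) (by
          rintro c ⟨-, hc⟩ d ⟨-, hd⟩
          linarith [dist_triangle_right c d b])
      obtain ⟨a, ha, haS⟩ := hEY.exists_mem (S := (fun p => (p.1, p.2 + n * s)) '' S)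
        (by rintro _ ⟨p, hp, rfl⟩; exact hS p hp)
        (by
          rintro _ ⟨p, hp, rfl⟩ _ ⟨q, hq, rfl⟩
          have := hc p hp q hq
          simp only
          linarith)
        (by
          rintro _ ⟨p, hp, rfl⟩
          obtain ⟨a, ha, hap⟩ := hprox p.1 p.2 (hS p hp) (hr p hp)
          obtain ⟨c, hcM, hcp, hcb⟩ := exists_mem_of_locally hMY hbetween hlocal hs (ρ := s)
            (r := p.2 + n * s) (hS p hp) ha hb hs.le (by linarith)
            (by rw [dist_comm]; linarith [hbS p hp])
          exact infDist_le_of_dist_le (hE ⟨hcM, hcb⟩) hcp)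
      exact ih a (hEM ha) fun p hp => haS _ (mem_image_of_mem _ hp)
  rcases S.eq_empty_or_nonempty with rfl | ⟨p₀, hp₀⟩
  · exact hM.imp fun a ha => ⟨ha, by simp⟩
  · obtain ⟨a, ha⟩ := hM
    obtain ⟨n, hn⟩ := exists_nat_ge ((p₀.2 + dist p₀.1 a) / s)
    rw [div_le_iff₀ hs] at hn
    refine hshrink n a ha fun p hp => ?_
    have h1 := dist_triangle p.1 p₀.1 a
    have h2 := hc p hp p₀ hp₀
    rw [dist_comm]
    linarith

end LocalToGlobal

/-! ### Gates, and the traces of balls they control. -/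

/-- The distance from `x` to points of `Y` is the distance to the externally hyperconvex set `G`
plus the constant `τ`. -/
def HasGate (x : Z) (Y G : Set Z) (τ : ℝ) : Prop :=
  IsExternallyHyperconvexIn G Y ∧ ∀ y ∈ Y, dist x y = τ + infDist y G

theorem HasGate.self {x : Z} (hx : x ∈ Y) : HasGate x Y {x} 0 :=
  ⟨.singleton hx, fun y _ => by simp [dist_comm]⟩

theorem HasGate.le {x : Z} {G : Set Z} {τ r : ℝ} (h : HasGate x Y G τ) {y : Z}
    (hy : y ∈ closedBall x r ∩ Y) : τ ≤ r := by
  have h1 := h.2 y hy.2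
  have h2 := hy.1
  rw [mem_closedBall, dist_comm] at h2
  linarith [infDist_nonneg (x := y) (s := G)]

theorem HasGate.mem_closedBall_iff {x : Z} {G : Set Z} {τ r : ℝ} (h : HasGate x Y G τ) {y : Z}
    (hy : y ∈ Y) : y ∈ closedBall x r ↔ infDist y G ≤ r - τ := by
  rw [mem_closedBall, dist_comm, h.2 y hy, le_sub_iff_add_le']

/-- The trace is the `(r - τ)`-neighbourhood of `G` in `Y`. Inflating the given balls by `r - τ`
yields a common point `g ∈ G`; hyperconvexity of `Y` then gives a point of the original balls within
`r - τ` of `g`. -/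
theorem HasGate.isExternallyHyperconvexIn {x : Z} {G : Set Z} {τ r : ℝ} (h : HasGate x Y G τ)
    (hY : HyperconvexOn Y) (hne : (closedBall x r ∩ Y).Nonempty) :
    IsExternallyHyperconvexIn (closedBall x r ∩ Y) Y := by
  have hτ : 0 ≤ r - τ := sub_nonneg.2 (h.le hne.some_mem)
  have hnear : ∀ y ∈ closedBall x r ∩ Y, infDist y G ≤ r - τ := fun y hy =>
    (h.mem_closedBall_iff hy.2).1 hy.1
  refine .of_exists_mem inter_subset_right hne fun S hS hc hr => ?_
  obtain ⟨g, hg, hgS⟩ := h.1.exists_mem (S := (fun p => (p.1, p.2 + (r - τ))) '' S)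
    (by rintro _ ⟨p, hp, rfl⟩; exact hS p hp)
    (by
      rintro _ ⟨p, hp, rfl⟩ _ ⟨q, hq, rfl⟩
      have := hc p hp q hq
      simp only
      linarith)
    (by
      rintro _ ⟨p, hp, rfl⟩
      refine le_of_forall_pos_le_add fun ε hε => ?_
      obtain ⟨a, ha, hap⟩ := exists_dist_lt_of_infDist_lt hne
        ((hr p hp).trans_lt (lt_add_of_pos_right _ hε))
      have := infDist_le_infDist_add (A := G) (x := p.1) (y := a) (r := p.2 + ε) (by rw [dist_comm]; exact hap.le)
      have := hnear a ha
      simp only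
      linarith)
  obtain ⟨z, hz, hzS⟩ := hY (insert (g, r - τ) S) (forall_mem_insert.2 ⟨h.1.subset hg, hS⟩)
    (hc.insert hτ fun p hp => (hgS _ (mem_image_of_mem _ hp)).trans (add_comm _ _).le)
  rw [forall_mem_insert] at hzS
  exact ⟨z, ⟨(h.mem_closedBall_iff hz).2 (infDist_le_of_dist_le hg
    (by rw [dist_comm]; exact hzS.1)), hz⟩, hzS.2⟩

theorem HasGate.exists_mem_of_dist_le {x y : Z} {G : Set Z} {τ r t : ℝ} (h : HasGate x Y G τ)
    (hY : HyperconvexOn Y) (hy : y ∈ Y) (hr : (closedBall x r ∩ Y).Nonempty) (ht : 0 ≤ t)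
    (hxy : dist x y ≤ r + t) : ∃ z ∈ Y, dist z x ≤ r ∧ dist z y ≤ t := by
  have hτ : 0 ≤ r - τ := sub_nonneg.2 (h.le hr.some_mem)
  rw [h.2 y hy] at hxy
  obtain ⟨g, hg, hgy⟩ := h.1.exists_dist_le hy le_rfl
  obtain ⟨z, hz, hzg, hzy⟩ := hY.exists_pair (h.1.subset hg) hy hτ ht (hgy.trans (by linarith))
  exact ⟨z, hz, (h.mem_closedBall_iff hz).2 (infDist_le_of_dist_le hg (by rwa [dist_comm])), hzy⟩

/-- A gate formula need only be checked on a set `B` through which almost shortest routes from `x`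
pass; in the gluing, `B` is a gluing set. -/
theorem HasGate.of_through {x : Z} {G : Set Z} {τ : ℝ} (hG : IsExternallyHyperconvexIn G Y)
    (hGB : G ⊆ B) (hB : ∀ b ∈ B, dist x b = τ + infDist b G)
    (hthrough : ∀ y ∈ Y, ∀ ε > 0, ∃ b ∈ B, dist x b + dist b y < dist x y + ε) :
    HasGate x Y G τ := by
  refine ⟨hG, fun y hy => le_antisymm ?_ (le_of_forall_pos_le_add fun ε hε => ?_)⟩
  · obtain ⟨g, hg, hgy⟩ := hG.exists_dist_le hy le_rfl
    have h1 := hB g (hGB hg)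
    rw [infDist_zero_of_mem hg] at h1
    linarith [dist_triangle x g y]
  · obtain ⟨b, hb, hby⟩ := hthrough y hy ε hε
    have h1 := hB b hb
    have h2 := infDist_le_infDist_add (A := G) (x := y) (y := b) (dist_comm y b).le
    linarith

theorem WeaklyExternallyHyperconvexIn.dist_eq (h : WeaklyExternallyHyperconvexIn A Y) {x a : Z}
    (hx : x ∈ Y) (ha : a ∈ A) :
    dist x a = infDist x A + infDist a (A ∩ closedBall x (infDist x A)) := by
  have h0 : infDist x A ≤ dist x a := infDist_le_dist_of_mem ha
  -- The radii about `x` and `a` add up to exactly `dist x a`; the ball about `a` is listed twice to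
  -- fill the third slot.
  obtain ⟨g, hg, hgx, hga, -⟩ := h.exists_mem (s := dist x a - infDist x A)
    (t := dist x a - infDist x A) hx le_rfl ha ha (sub_nonneg.2 h0) (sub_nonneg.2 h0)
    (by linarith) (by linarith) (by rw [dist_self]; linarith)
  refine le_antisymm ?_ ?_
  · have hne : (A ∩ closedBall x (infDist x A)).Nonempty := ⟨g, hg, hgx⟩
    refine le_of_forall_pos_le_add fun ε hε => ?_
    obtain ⟨b, hb, hba⟩ := exists_dist_lt_of_infDist_lt (x := a) hne (lt_add_of_pos_right _ hε)
    have h1 : dist b x ≤ infDist x A := hb.2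
    linarith [dist_triangle_left x a b]
  · have := infDist_le_of_dist_le (A := A ∩ closedBall x (infDist x A)) ⟨hg, hgx⟩ hga
    linarith

end ExternallyHyperconvex

/-! ### Gates, separators and the Helly argument in the gluing. -/

section SubspaceGluing

variable {Z : Type*} [MetricSpace Z] {Λ : Type*}

/-- The metric space `Z` is the gluing of its hyperconvex subspaces `Y i` to the hyperconvex
subspace `X₀` along the sets `A i`. -/
structure IsSubspaceGluing (X₀ : Set Z) (Y A : Λ → Set Z) : Prop where
  cover (z : Z) : z ∈ X₀ ∨ ∃ i, z ∈ Y i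
  disjoint (i j : Λ) : i ≠ j → Disjoint (A i) (A j)
  hyperconvex_base : HyperconvexOn X₀
  hyperconvex (i : Λ) : HyperconvexOn (Y i)
  weakly_base (i : Λ) : WeaklyExternallyHyperconvexIn (A i) X₀
  weakly (i : Λ) : WeaklyExternallyHyperconvexIn (A i) (Y i)
  gate_base (i : Λ) (x : Z) : x ∈ Y i →
    IsExternallyHyperconvexIn (A i ∩ closedBall x (infDist x (A i))) X₀
  gate (i : Λ) (x : Z) : x ∈ X₀ →
    IsExternallyHyperconvexIn (A i ∩ closedBall x (infDist x (A i))) (Y i)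
  through (i : Λ) (x y : Z) : x ∈ Y i → (y ∈ X₀ ∨ ∃ j, j ≠ i ∧ y ∈ Y j) → ∀ ε > 0,
    ∃ a ∈ A i, dist x a + dist a y < dist x y + ε

namespace IsSubspaceGluing

variable {X₀ : Set Z} {Y A : Λ → Set Z} (h : IsSubspaceGluing X₀ Y A) {i j : Λ} {x y : Z}
  {r t : ℝ} {F G : Set Z}

include h

theorem hasGate_base_of_mem (hx : x ∈ Y i) :
    HasGate x X₀ (A i ∩ closedBall x (infDist x (A i))) (infDist x (A i)) :=
  .of_through (h.gate_base i x hx) inter_subset_left (fun _ ha => (h.weakly i).dist_eq hx ha)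
    fun y hy => h.through i x y hx (Or.inl hy)

theorem exists_hasGate_base (x : Z) : ∃ G τ, HasGate x X₀ G τ := by
  rcases h.cover x with hx | ⟨i, hx⟩
  · exact ⟨_, _, .self hx⟩
  · exact ⟨_, _, h.hasGate_base_of_mem hx⟩

theorem trace_base (hne : (closedBall x r ∩ X₀).Nonempty) :
    IsExternallyHyperconvexIn (closedBall x r ∩ X₀) X₀ := by
  obtain ⟨G, τ, hG⟩ := h.exists_hasGate_base x
  exact hG.isExternallyHyperconvexIn h.hyperconvex_base hne

theorem hasGate_of_mem_base (i : Λ) (hx : x ∈ X₀) :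
    HasGate x (Y i) (A i ∩ closedBall x (infDist x (A i))) (infDist x (A i)) := by
  refine .of_through (h.gate i x hx) inter_subset_left
    (fun _ ha => (h.weakly_base i).dist_eq hx ha) fun y hy ε hε => ?_
  obtain ⟨a, ha, hay⟩ := h.through i y x hy (Or.inl hx) ε hε
  exact ⟨a, ha, by rwa [add_comm, dist_comm a y, dist_comm x a, dist_comm x y]⟩

/-- The set of points of `A i` nearest to `E`. -/
theorem nearest_isExternallyHyperconvexIn {E : Set Z} (hE : IsExternallyHyperconvexIn E X₀)
    {s : ℝ} (hs : 0 < s) (hle : ∀ a ∈ A i, s ≤ infDist a E)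
    (hne : {a | a ∈ A i ∧ infDist a E ≤ s}.Nonempty) :
    IsExternallyHyperconvexIn {a | a ∈ A i ∧ infDist a E ≤ s} (Y i) := by
  refine .of_locally (s := s) (fun a ha => (h.weakly i).1 ha.1) ?_ ?_ hs hne
  · intro a ha b hb ρ σ hρ hσ hab
    obtain ⟨c, hc, hcE, hca, hcb⟩ := (h.weakly_base i).exists_mem_near hE hs le_rfl ha.1 hb.1 ha.2
      (hb.2.trans (by simp)) hρ hσ hab
    exact ⟨c, ⟨hc, hcE⟩, hca, hcb⟩
  · intro T hT hTd
    rcases T.eq_empty_or_nonempty with rfl | ⟨a₀, ha₀⟩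
    · obtain ⟨a, ha⟩ := hne
      exact ⟨{a}, by simpa using ha, empty_subset _, .singleton ((h.weakly i).1 ha.1)⟩
    -- Diameter at most `2 * s` makes the balls of radius `s` about `T` compatible, so a single `e ∈
    -- E` is nearest to all of `T`. Its nearest-point set in `A i` is the required local set.
    obtain ⟨e, he, heT⟩ := hE.exists_mem (S := (fun a => (a, s)) '' T)
      (by rintro _ ⟨a, ha, rfl⟩; exact (h.weakly_base i).1 (hT ha).1)
      (by
        rintro _ ⟨a, ha, rfl⟩ _ ⟨b, hb, rfl⟩
        exact (hTd a ha b hb).trans (two_mul s).le)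
      (by rintro _ ⟨a, ha, rfl⟩; exact (hT ha).2)
    have hes : infDist e (A i) = s := by
      refine le_antisymm ((infDist_le_dist_of_mem (hT ha₀).1).trans
        (heT _ (mem_image_of_mem _ ha₀))) ((le_infDist ⟨a₀, (hT ha₀).1⟩).2 fun a ha => ?_)
      rw [dist_comm]
      exact (hle a ha).trans (infDist_le_dist_of_mem he)
    refine ⟨_, ?_, ?_, h.gate i e (hE.subset he)⟩
    · rintro a ⟨ha, hae⟩
      rw [hes, mem_closedBall, dist_comm] at hae
      exact ⟨ha, infDist_le_of_dist_le he hae⟩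
    · intro a ha
      refine ⟨(hT ha).1, ?_⟩
      rw [hes, mem_closedBall, dist_comm]
      exact heT _ (mem_image_of_mem _ ha)

/-- On `X₀` the distance from `x` is governed by a gate `E ⊆ A j`, and routes enter `Y i` through `A
i`. So the gate is the set of points of `A i` nearest to `E`. Their distance `s` to `E` is attained,
hence positive by disjointness. -/
theorem exists_hasGate_of_mem_ne (hij : j ≠ i) (hx : x ∈ Y j) : ∃ G τ, HasGate x (Y i) G τ := by
  set E := A j ∩ closedBall x (infDist x (A j)) with hEdef
  have hE := h.gate_base j x hx
  have hgate := h.hasGate_base_of_mem hx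
  rw [← hEdef] at hE hgate
  have hne : (A i).Nonempty := (h.gate i _ (hE.subset hE.nonempty.some_mem)).nonempty.mono
    inter_subset_left
  have : Nonempty (A i) := hne.to_subtype
  let s := ⨅ a : A i, infDist (a : Z) E
  have hle : ∀ a ∈ A i, s ≤ infDist a E := fun a ha =>
    ciInf_le (f := fun a : A i => infDist (a : Z) E)
      ⟨0, by rintro _ ⟨a, rfl⟩; exact infDist_nonneg⟩ ⟨a, ha⟩
  have hs0 : 0 ≤ s := le_ciInf fun a => infDist_nonneg
  obtain ⟨a, ha, has⟩ := (h.weakly_base i).exists_infDist_le hE hs0 fun ε hε => by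
    obtain ⟨a, ha⟩ := exists_lt_of_ciInf_lt (lt_add_of_pos_right s hε)
    exact ⟨a, a.2, ha.le⟩
  have hs : 0 < s := by
    refine lt_of_not_ge fun hs => ?_
    exact disjoint_left.1 (h.disjoint i j hij.symm) ha
      (hE.mem_of_infDist_le_zero ((h.weakly_base i).1 ha) (has.trans hs)).1
  have hP := h.nearest_isExternallyHyperconvexIn hE hs hle ⟨a, ha, has⟩
  refine ⟨_, infDist x (A j) + s, .of_through hP (fun a ha => ha.1) ?_ fun y hy ε hε => ?_⟩
  · intro b hb
    rw [hgate.2 b ((h.weakly_base i).1 hb), add_assoc, add_right_inj]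
    refine le_antisymm ?_ ?_
    · refine le_of_forall_pos_le_add fun ε hε => ?_
      obtain ⟨c, hc, hcb⟩ := exists_dist_lt_of_infDist_lt (x := b) hP.nonempty
        (lt_add_of_pos_right _ hε)
      have := infDist_le_infDist_add (A := E) (x := b) (y := c) (r := infDist b _ + ε)
        (by rw [dist_comm]; exact hcb.le)
      linarith [hc.2]
    · obtain ⟨c, hc, hcE, -, hcb⟩ := (h.weakly_base i).exists_mem_near hE
        (δ := infDist b E - s) (σ := infDist b E - s) hs (sub_nonneg.2 (hle b hb)) ha hb has
        (by linarith) dist_nonneg le_rfl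
        (le_add_of_nonneg_right (sub_nonneg.2 (hle b hb)))
      have := infDist_le_of_dist_le (A := {a | a ∈ A i ∧ infDist a E ≤ s}) ⟨hc, hcE⟩ hcb
      linarith
  · obtain ⟨a, ha, hay⟩ := h.through i y x hy (Or.inr ⟨j, hij, hx⟩) ε hε
    exact ⟨a, ha, by rwa [add_comm, dist_comm a y, dist_comm x a, dist_comm x y]⟩

theorem exists_hasGate (i : Λ) (x : Z) : ∃ G τ, HasGate x (Y i) G τ := by
  rcases h.cover x with hx | ⟨j, hx⟩
  · exact ⟨_, _, h.hasGate_of_mem_base i hx⟩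
  · rcases eq_or_ne j i with rfl | hij
    · exact ⟨_, _, .self hx⟩
    · exact h.exists_hasGate_of_mem_ne hij hx

/-- Compatible balls that reach `X₀` meet in `X₀`, unless they belong to the same piece. -/
theorem inter_trace_nonempty_of_mem (hx : x ∈ Y i) (hy : y ∈ X₀ ∨ ∃ j, j ≠ i ∧ y ∈ Y j)
    (hxr : (closedBall x r ∩ X₀).Nonempty) (hyt : (closedBall y t ∩ X₀).Nonempty)
    (hxy : dist x y ≤ r + t) :
    ((closedBall x r ∩ X₀) ∩ (closedBall y t ∩ X₀)).Nonempty := by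
  obtain ⟨G, τ, hG⟩ := h.exists_hasGate_base x
  obtain ⟨G', τ', hG'⟩ := h.exists_hasGate_base y
  have hr : 0 ≤ r - τ := sub_nonneg.2 (hG.le hxr.some_mem)
  have ht : 0 ≤ t - τ' := sub_nonneg.2 (hG'.le hyt.some_mem)
  -- Almost shortest routes cross `A i ⊆ X₀`, where both gate formulas apply; they bound the
  -- distance between the gates by `(r - τ) + (t - τ')`.
  obtain ⟨a, ha, haG'⟩ := hG.1.weakly.exists_infDist_le hG'.1 (add_nonneg hr ht) fun ε hε => by
    obtain ⟨b, hb, hbxy⟩ := h.through i x y hx hy ε hε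
    have hb₀ := (h.weakly_base i).1 hb
    rw [dist_comm b y, hG.2 b hb₀, hG'.2 b hb₀] at hbxy
    obtain ⟨g, hg, hgb⟩ := hG.1.exists_dist_le hb₀ le_rfl
    refine ⟨g, hg, (infDist_le_infDist_add hgb).trans ?_⟩
    linarith
  obtain ⟨b, hb, hba⟩ := hG'.1.exists_dist_le (hG.1.subset ha) haG'
  obtain ⟨z, hz, hza, hzb⟩ := h.hyperconvex_base.exists_pair (hG.1.subset ha) (hG'.1.subset hb)
    hr ht (by rwa [dist_comm])
  exact ⟨z, ⟨(hG.mem_closedBall_iff hz).2 (infDist_le_of_dist_le ha (by rwa [dist_comm])), hz⟩,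
    (hG'.mem_closedBall_iff hz).2 (infDist_le_of_dist_le hb (by rwa [dist_comm])), hz⟩

theorem inter_trace_nonempty_or (hxr : (closedBall x r ∩ X₀).Nonempty)
    (hyt : (closedBall y t ∩ X₀).Nonempty) (hr : 0 ≤ r) (ht : 0 ≤ t) (hxy : dist x y ≤ r + t) :
    ((closedBall x r ∩ X₀) ∩ (closedBall y t ∩ X₀)).Nonempty ∨ ∃ i, x ∈ Y i ∧ y ∈ Y i := by
  rcases h.cover x with hx | ⟨i, hx⟩
  · rcases h.cover y with hy | ⟨j, hy⟩
    · obtain ⟨z, hz, hzx, hzy⟩ := h.hyperconvex_base.exists_pair hx hy hr ht hxy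
      exact Or.inl ⟨z, ⟨hzx, hz⟩, hzy, hz⟩
    · left
      rw [inter_comm]
      exact h.inter_trace_nonempty_of_mem hy (Or.inl hx) hyt hxr
        (by rwa [dist_comm, add_comm])
  · by_cases hy : y ∈ Y i
    · exact Or.inr ⟨i, hx, hy⟩
    · refine Or.inl (h.inter_trace_nonempty_of_mem hx ((h.cover y).imp_right ?_) hxr hyt hxy)
      rintro ⟨j, hj⟩
      exact ⟨j, by rintro rfl; exact hy hj, hj⟩

/-- Two compatible balls of one piece that reach `X₀` but do not meet there are separated by an
externally hyperconvex subset of the gluing set. -/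
theorem exists_separator (hx : x ∈ Y i) (hy : y ∈ Y i) (hxr : (closedBall x r ∩ X₀).Nonempty)
    (hyt : (closedBall y t ∩ X₀).Nonempty) (hxy : dist x y ≤ r + t)
    (hdis : ¬((closedBall x r ∩ X₀) ∩ (closedBall y t ∩ X₀)).Nonempty) :
    ∃ M ⊆ A i, IsExternallyHyperconvexIn M X₀ ∧ ∀ F, IsExternallyHyperconvexIn F X₀ →
      (F ∩ (closedBall x r ∩ X₀)).Nonempty → (F ∩ (closedBall y t ∩ X₀)).Nonempty →
      (M ∩ F).Nonempty := by
  have hCx := h.trace_base hxr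
  have hCy := h.trace_base hyt
  set C := closedBall x r ∩ X₀
  set D := closedBall y t ∩ X₀
  have : Nonempty C := hxr.to_subtype
  let s := ⨅ a : C, infDist (a : Z) D
  have hle : ∀ a ∈ C, s ≤ infDist a D := fun a ha =>
    ciInf_le (f := fun a : C => infDist (a : Z) D)
      ⟨0, by rintro _ ⟨a, rfl⟩; exact infDist_nonneg⟩ ⟨a, ha⟩
  have hs0 : 0 ≤ s := le_ciInf fun a => infDist_nonneg
  obtain ⟨a, ha, has⟩ := hCx.weakly.exists_infDist_le hCy hs0 fun ε hε => by
    obtain ⟨a, ha⟩ := exists_lt_of_ciInf_lt (lt_add_of_pos_right s hε)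
    exact ⟨a, a.2, ha.le⟩
  have hs : 0 < s := by
    refine lt_of_not_ge fun hs => hdis ⟨a, ha, ?_⟩
    exact hCy.mem_of_infDist_le_zero ha.2 (has.trans hs)
  obtain ⟨b, hb, hba⟩ := hCy.exists_dist_le ha.2 has
  obtain ⟨m, hm, hma, hmb⟩ := h.hyperconvex_base.exists_pair (r := s / 2) (t := s / 2) ha.2 hb.2
    (by positivity) (by positivity) (by rw [dist_comm]; linarith)
  have hmx : m ∈ closedBall x (r + s / 2) ∩ X₀ :=
    ⟨(dist_triangle m a x).trans (by linarith [mem_closedBall.1 ha.1]), hm⟩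
  have hmy : m ∈ closedBall y (t + s / 2) ∩ X₀ :=
    ⟨(dist_triangle m b y).trans (by linarith [mem_closedBall.1 hb.1]), hm⟩
  have hCx' := h.trace_base ⟨m, hmx⟩
  have hCy' := h.trace_base ⟨m, hmy⟩
  -- Such a `z` would be within `α` of both traces, whose gap is `s > 2 * α`.
  have hsep : ∀ α, 0 ≤ α → α < s / 2 → ∀ z ∈ X₀, dist z x ≤ r + α → dist z y ≤ t + α → False := by
    intro α hα hαs z hz hzx hzy
    obtain ⟨G, τ, hG⟩ := h.exists_hasGate_base x
    obtain ⟨G', τ', hG'⟩ := h.exists_hasGate_base y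
    obtain ⟨u, hu, hux, huz⟩ := hG.exists_mem_of_dist_le h.hyperconvex_base hz hxr hα
      (by rwa [dist_comm])
    obtain ⟨v, hv, hvy, hvz⟩ := hG'.exists_mem_of_dist_le h.hyperconvex_base hz hyt hα
      (by rwa [dist_comm])
    have h1 : infDist u D ≤ dist u v := infDist_le_dist_of_mem ⟨hvy, hv⟩
    have h2 := hle u ⟨hux, hu⟩
    linarith [dist_triangle_right u v z]
  -- The separator consists of the points of `X₀` in both balls enlarged by `s / 2`.
  refine ⟨_, ?_, hCx'.inter hCy' ⟨m, hmx, hmy⟩, fun F hF hFx hFy => ?_⟩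
  · rintro z ⟨⟨hzx, hz⟩, hzy, -⟩
    rw [mem_closedBall] at hzx hzy
    have hgate := h.hasGate_of_mem_base i hz
    set P := A i ∩ closedBall z (infDist z (A i))
    set d := infDist z (A i)
    have hd0 : 0 ≤ d := infDist_nonneg
    have hx1 := hgate.2 x hx
    have hy1 := hgate.2 y hy
    suffices hd0' : d ≤ 0 by
      have hclosed : IsExternallyHyperconvexIn (A i) (A i ∪ {z}) := (h.weakly_base i).2 z hz
      exact hclosed.mem_of_infDist_le_zero (by simp) hd0'
    refine le_of_not_gt fun hdpos => ?_
    -- Distances from `z` to `x` and `y` run through the gate of `z` in `A i`, so moving from `z` to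
    -- that gate saves `d` on both. If `d > 0`, this contradicts `hsep`.
    obtain ⟨p, hp, hpx, hpy⟩ := hgate.1.exists_mem_pair (r := r + max (s / 2 - d) 0)
      (t := t + max (s / 2 - d) 0) hx hy
      (by linarith [le_max_left (s / 2 - d) 0])
      (by linarith [le_max_left (s / 2 - d) 0])
      (by linarith [le_max_right (s / 2 - d) 0])
    exact hsep _ (le_max_right _ _) (max_lt (by linarith) (by linarith)) p
      ((h.weakly_base i).1 hp.1) hpx hpy
  · refine IsExternallyHyperconvexIn.inter_inter_nonempty hCx' hCy' hF ⟨m, hmx, hmy⟩ ?_ ?_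
    · rw [inter_comm]
      exact hFx.mono (inter_subset_inter_right _ (inter_subset_inter_left _
        (closedBall_subset_closedBall (by linarith))))
    · rw [inter_comm]
      exact hFy.mono (inter_subset_inter_right _ (inter_subset_inter_left _
        (closedBall_subset_closedBall (by linarith))))

variable {S : Set (Z × ℝ)}

/-- If an externally hyperconvex subset of one gluing set meets the traces of all balls centred
outside the piece, then the balls have a common point in that piece. -/
theorem exists_mem_of_separator (hS : BallsCompatible S) (hSne : S.Nonempty) {M : Set Z}
    (hMA : M ⊆ A i) (hM : IsExternallyHyperconvexIn M X₀)
    (hMS : ∀ p ∈ S, p.1 ∈ Y i ∨ (M ∩ (closedBall p.1 p.2 ∩ X₀)).Nonempty) :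
    ∃ z, ∀ p ∈ S, dist z p.1 ≤ p.2 := by
  have hMY : M ⊆ Y i := hMA.trans (h.weakly i).1
  have hne : ∀ p ∈ S, (closedBall p.1 p.2 ∩ Y i).Nonempty := fun p hp => by
    rcases hMS p hp with hpi | ⟨z, hzM, hz, -⟩
    · exact ⟨p.1, mem_closedBall_self (hS.nonneg hp), hpi⟩
    · exact ⟨z, hz, hMY hzM⟩
  have hmem : ∀ p ∈ S, ∀ q ∈ S, q.1 ∈ Y i →
      ((closedBall p.1 p.2 ∩ Y i) ∩ (closedBall q.1 q.2 ∩ Y i)).Nonempty := by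
    intro p hp q hq hqi
    obtain ⟨G, τ, hG⟩ := h.exists_hasGate i p.1
    obtain ⟨z, hz, hzp, hzq⟩ := hG.exists_mem_of_dist_le (h.hyperconvex i) hqi (hne p hp)
      (hS.nonneg hq) (hS p hp q hq)
    exact ⟨z, ⟨hzp, hz⟩, hzq, hz⟩
  obtain ⟨p₀, hp₀⟩ := hSne
  obtain ⟨z, hz⟩ := IsExternallyHyperconvexIn.sInter_nonempty (Y := Y i)
    (D := (fun p => closedBall p.1 p.2 ∩ Y i) '' S) (by
      rintro _ ⟨p, hp, rfl⟩
      obtain ⟨G, τ, hG⟩ := h.exists_hasGate i p.1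
      exact hG.isExternallyHyperconvexIn (h.hyperconvex i) (hne p hp))
    (by
      rintro _ ⟨p, hp, rfl⟩ _ ⟨q, hq, rfl⟩
      rcases hMS q hq with hqi | hMq
      · exact hmem p hp q hq hqi
      rcases hMS p hp with hpi | hMp
      · simp only
        rw [inter_comm]
        exact hmem q hq p hp hpi
      have hp' := hMp.mono inter_subset_right
      have hq' := hMq.mono inter_subset_right
      by_cases hpq : ((closedBall p.1 p.2 ∩ X₀) ∩ (closedBall q.1 q.2 ∩ X₀)).Nonempty
      · obtain ⟨z, ⟨hzM, hzp, -⟩, hzq, -⟩ := hM.inter_inter_nonempty (h.trace_base hp')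
          (h.trace_base hq') hMp hMq hpq
        exact ⟨z, ⟨hzp, hMY hzM⟩, hzq, hMY hzM⟩
      obtain ⟨j, hpj, hqj⟩ := (h.inter_trace_nonempty_or hp' hq' (hS.nonneg hp) (hS.nonneg hq)
        (hS p hp q hq)).resolve_left hpq
      rcases eq_or_ne i j with rfl | hij
      · exact hmem p hp q hq hqj
      -- `M` reaches both traces, so the separator `M' ⊆ A j` must meet `M ⊆ A i`, against
      -- disjointness.
      obtain ⟨M', hM'A, -, hM'⟩ := h.exists_separator hpj hqj hp' hq' (hS p hp q hq) hpq
      obtain ⟨z, hzM', hzM⟩ := hM' M hM hMp hMq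
      exact (disjoint_left.1 (h.disjoint i j hij) (hMA hzM) (hM'A hzM')).elim)
    (mem_image_of_mem _ hp₀) (isBounded_closedBall.subset inter_subset_left)
  exact ⟨z, fun p hp => (hz _ (mem_image_of_mem _ hp)).1⟩

theorem mem_of_not_mem (hy : y ∉ Y i) : y ∈ X₀ ∨ ∃ j, j ≠ i ∧ y ∈ Y j :=
  (h.cover y).imp_right fun ⟨j, hj⟩ => ⟨j, by rintro rfl; exact hy hj, hj⟩

theorem exists_mem (hS : BallsCompatible S) : ∃ z, ∀ p ∈ S, dist z p.1 ≤ p.2 := by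
  rcases S.eq_empty_or_nonempty with rfl | hSne
  · obtain ⟨z, -, -⟩ := h.hyperconvex_base ∅ (by simp) ballsCompatible_empty
    exact ⟨z, by simp⟩
  by_cases hdeep : ∀ p ∈ S, (closedBall p.1 p.2 ∩ X₀).Nonempty
  · by_cases hpair : ∀ p ∈ S, ∀ q ∈ S,
        ((closedBall p.1 p.2 ∩ X₀) ∩ (closedBall q.1 q.2 ∩ X₀)).Nonempty
    · obtain ⟨p₀, hp₀⟩ := hSne
      obtain ⟨z, hz⟩ := IsExternallyHyperconvexIn.sInter_nonempty (Y := X₀)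
        (D := (fun p => closedBall p.1 p.2 ∩ X₀) '' S)
        (by rintro _ ⟨p, hp, rfl⟩; exact h.trace_base (hdeep p hp))
        (by rintro _ ⟨p, hp, rfl⟩ _ ⟨q, hq, rfl⟩; exact hpair p hp q hq)
        (mem_image_of_mem _ hp₀) (isBounded_closedBall.subset inter_subset_left)
      exact ⟨z, fun p hp => (hz _ (mem_image_of_mem _ hp)).1⟩
    · push Not at hpair
      obtain ⟨p, hp, q, hq, hpq⟩ := hpair
      rw [← not_nonempty_iff_eq_empty] at hpq
      obtain ⟨i, hpi, hqi⟩ := (h.inter_trace_nonempty_or (hdeep p hp) (hdeep q hq) (hS.nonneg hp)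
        (hS.nonneg hq) (hS p hp q hq)).resolve_left hpq
      obtain ⟨M, hMA, hM, hMF⟩ := h.exists_separator hpi hqi (hdeep p hp) (hdeep q hq)
        (hS p hp q hq) hpq
      refine h.exists_mem_of_separator hS hSne hMA hM fun k hk => or_iff_not_imp_left.2 fun hki => ?_
      have hk' := h.mem_of_not_mem hki
      refine hMF _ (h.trace_base (hdeep k hk)) ?_ ?_
      · rw [inter_comm]
        exact h.inter_trace_nonempty_of_mem hpi hk' (hdeep p hp) (hdeep k hk) (hS p hp k hk)
      · rw [inter_comm]
        exact h.inter_trace_nonempty_of_mem hqi hk' (hdeep q hq) (hdeep k hk) (hS q hq k hk)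
  · push Not at hdeep
    obtain ⟨p, hp, hpe⟩ := hdeep
    have hpX : p.1 ∉ X₀ := fun hpX =>
      hpe.subset ⟨mem_closedBall_self (hS.nonneg hp), hpX⟩
    obtain ⟨i, hpi⟩ := (h.cover p.1).resolve_left hpX
    have hgate := h.hasGate_base_of_mem hpi
    have hdist : p.2 < infDist p.1 (A i) := by
      refine lt_of_not_ge fun hle => ?_
      obtain ⟨g, hgA, hg⟩ := hgate.1.nonempty
      exact hpe.subset ⟨(mem_closedBall.1 hg).trans hle, (h.weakly_base i).1 hgA⟩
    refine h.exists_mem_of_separator hS hSne inter_subset_left hgate.1 fun k hk =>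
      or_iff_not_imp_left.2 fun hki => ?_
    -- The admissible error is the positive gap `infDist p.1 (A i) - p.2`. After substituting the
    -- gate formula for `dist p.1 a`, it leaves exactly the radius `k.2` for the way from the gate
    -- to `k.1`.
    obtain ⟨a, ha, hak⟩ := h.through i p.1 k.1 hpi (h.mem_of_not_mem hki) _ (sub_pos.2 hdist)
    rw [(h.weakly i).dist_eq hpi ha] at hak
    obtain ⟨g, hg, hga⟩ := hgate.1.exists_dist_le ((h.weakly_base i).1 ha) le_rfl
    refine ⟨g, hg, (dist_triangle g a k.1).trans ?_, hgate.1.subset hg⟩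
    linarith [hS p hp k hk]

end IsSubspaceGluing

end SubspaceGluing

/-! ### Transfer of the hypotheses to subspaces of the quotient. -/

theorem IsHyperconvex.hyperconvexOn_range {W Z : Type*} [MetricSpace W] [MetricSpace Z]
    (h : IsHyperconvex W) {f : W → Z} (hf : Isometry f) : HyperconvexOn (range f) := by
  intro S hS hc
  obtain ⟨w, hw⟩ := h {p | (f p.1, p.2) ∈ S} fun p hp q hq => by
    simpa [hf.dist_eq] using hc _ hp _ hq
  refine ⟨f w, mem_range_self w, fun p hp => ?_⟩
  obtain ⟨y, hy⟩ := hS p hp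
  have h1 : w ∈ closedBall y p.2 := mem_iInter₂.1 hw (y, p.2) (by simpa [hy] using hp)
  rwa [mem_closedBall, ← hf.dist_eq, hy] at h1

theorem IsWeaklyExternallyHyperconvex.image {W Z : Type*} [MetricSpace W] [MetricSpace Z]
    {A : Set W} (h : IsWeaklyExternallyHyperconvex A) {f : W → Z} (hf : Isometry f) :
    WeaklyExternallyHyperconvexIn (f '' A) (range f) := by
  refine ⟨image_subset_range f A, ?_⟩
  rintro _ ⟨x, rfl⟩
  rw [← image_singleton, ← image_union]
  exact (h.2 x).image hf

theorem isHyperconvex_of_exists_mem {Z : Type*} [MetricSpace Z]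
    (h : ∀ S : Set (Z × ℝ), BallsCompatible S → ∃ z, ∀ p ∈ S, dist z p.1 ≤ p.2) :
    IsHyperconvex Z := by
  intro S hS
  obtain ⟨z, hz⟩ := h S hS
  exact ⟨z, mem_iInter₂.2 hz⟩

/-- The two spaces play interchangeable roles, so both gate conditions of the gluing come from this
one statement. -/
theorem image_isExternallyHyperconvexIn {W W' V Z : Type*} [MetricSpace W] [MetricSpace W']
    [MetricSpace Z] {f : W → Z} {g : W' → Z} {κ : V → W} {ι : V → W'} (hf : Isometry f)
    (hg : Isometry g) (hκι : ∀ a, f (κ a) = g (ι a)) {x : W'}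
    (h : IsExternallyHyperconvex (κ '' (ι ⁻¹' closedBall x (infDist x (range ι))))) :
    IsExternallyHyperconvexIn
      (range (fun a => f (κ a)) ∩ closedBall (g x) (infDist (g x) (range fun a => f (κ a))))
      (range f) := by
  have hrange : range (fun a => f (κ a)) = g '' range ι := by
    rw [← range_comp]
    exact congrArg range (funext hκι)
  have himage := h.image hf
  rw [image_univ] at himage
  convert himage using 1
  rw [hrange, infDist_image hg]
  ext z
  constructor
  · rintro ⟨⟨_, ⟨a, rfl⟩, rfl⟩, hz⟩
    rw [mem_closedBall, hg.dist_eq] at hz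
    exact ⟨κ a, ⟨a, hz, rfl⟩, hκι a⟩
  · rintro ⟨_, ⟨a, ha, rfl⟩, rfl⟩
    rw [hκι]
    refine ⟨mem_image_of_mem g (mem_range_self a), ?_⟩
    rw [mem_closedBall, hg.dist_eq]
    exact ha

theorem mainTheorem8 {X₀ : Type*} {Λ : Type*} {X : Λ → Type*} {A : Λ → Type*}
    [MetricSpace X₀] [∀ i, MetricSpace (X i)] [∀ i, MetricSpace (A i)]
    (κ : ∀ i, A i → X₀) (ι : ∀ i, A i → X i)
    (hκ : ∀ i, Isometry (κ i)) (hι : ∀ i, Isometry (ι i))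
    (hX₀ : IsHyperconvex X₀) (hX : ∀ i, IsHyperconvex (X i))
    (hA : ∀ i, IsWeaklyExternallyHyperconvex (range (ι i)))
    (hA₀ : ∀ i, IsWeaklyExternallyHyperconvex (range (κ i)))
    (hdisj : ∀ i j, i ≠ j → Disjoint (range (κ i)) (range (κ j)))
    (hE₀ : ∀ i (x : X i), IsExternallyHyperconvex
      (κ i '' (ι i ⁻¹' closedBall x (infDist x (range (ι i))))))
    (hE : ∀ i (x : X₀), IsExternallyHyperconvex
      (ι i '' (κ i ⁻¹' closedBall x (infDist x (range (κ i)))))) :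
    @IsHyperconvex (Glued κ ι)
      (Glued.metricSpace (fun i => (hA i).nonempty_of_range) hκ hι (fun i => (hA i).isClosed)) := by
  have hne : ∀ i, Nonempty (A i) := fun i => (hA i).nonempty_of_range
  let _ : MetricSpace (Glued κ ι) := Glued.metricSpace hne hκ hι fun i => (hA i).isClosed
  let f : X₀ → Glued κ ι := fun x => Quot.mk _ (.inl x)
  let g : ∀ i, X i → Glued κ ι := fun i x => Quot.mk _ (.inr ⟨i, x⟩)
  have hf : Isometry f := Isometry.of_dist_eq fun x y => rfl
  have hg : ∀ i, Isometry (g i) := fun i => Isometry.of_dist_eq fun x y =>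
    glueDistance_same κ ι i x y
  have hglue : ∀ i a, f (κ i a) = g i (ι i a) := fun i a => Quot.sound (GlueRel.glue i a)
  have hrange : ∀ i, range (fun a => f (κ i a)) = range fun a => g i (ι i a) := fun i =>
    congrArg range (funext (hglue i))
  have hgluing : IsSubspaceGluing (range f) (fun i => range (g i))
      (fun i => range fun a => f (κ i a)) :=
    { cover := by
        rintro ⟨x | ⟨i, x⟩⟩
        · exact Or.inl ⟨x, rfl⟩
        · exact Or.inr ⟨i, x, rfl⟩
      disjoint := by
        intro i j hij
        rw [disjoint_left]
        rintro _ ⟨a, rfl⟩ ⟨b, hb⟩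
        exact disjoint_left.1 (hdisj i j hij) ⟨a, rfl⟩ ⟨b, hf.injective hb⟩
      hyperconvex_base := hX₀.hyperconvexOn_range hf
      hyperconvex := fun i => (hX i).hyperconvexOn_range (hg i)
      weakly_base := fun i => by
        rw [show range (fun a => f (κ i a)) = f '' range (κ i) from range_comp f (κ i)]
        exact (hA₀ i).image hf
      weakly := fun i => by
        rw [hrange i,
          show range (fun a => g i (ι i a)) = g i '' range (ι i) from range_comp (g i) (ι i)]
        exact (hA i).image (hg i)
      gate_base := by
        rintro i _ ⟨x, rfl⟩
        exact image_isExternallyHyperconvexIn hf (hg i) (hglue i) (hE₀ i x)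
      gate := by
        rintro i _ ⟨x, rfl⟩
        simp only [hrange i]
        exact image_isExternallyHyperconvexIn (hg i) hf (fun a => (hglue i a).symm) (hE i x)
      through := by
        rintro i _ _ ⟨x, rfl⟩ (⟨y, rfl⟩ | ⟨j, hj, y, rfl⟩) ε hε
        · obtain ⟨a, ha⟩ := exists_lt_of_glueDistance_zero_lt κ ι y i x
            (lt_add_of_pos_right _ hε)
          refine ⟨_, ⟨a, rfl⟩, ?_⟩
          have h1 : dist (f y) (g i x) = glueDistance κ ι (.inl y) (.inr ⟨i, x⟩) := rfl
          have h2 : dist (g i x) (f (κ i a)) = dist (ι i a) x := by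
            rw [hglue, (hg i).dist_eq, dist_comm]
          have h3 : dist (f (κ i a)) (f y) = dist y (κ i a) := by
            rw [hf.dist_eq, dist_comm]
          rw [dist_comm (g i x) (f y), h1, h2, h3]
          linarith
        · obtain ⟨a, b, hab⟩ := exists_lt_of_glueDistance_ne_lt κ ι hj.symm x y
            (lt_add_of_pos_right _ hε)
          refine ⟨_, ⟨a, rfl⟩, ?_⟩
          have h1 : dist (g i x) (g j y) = glueDistance κ ι (.inr ⟨i, x⟩) (.inr ⟨j, y⟩) := rfl
          have h2 : dist (g i x) (f (κ i a)) = dist x (ι i a) := by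
            rw [hglue, (hg i).dist_eq]
          have h3 := dist_triangle (f (κ i a)) (f (κ j b)) (g j y)
          have h4 : dist (f (κ j b)) (g j y) = dist (ι j b) y := by
            rw [hglue, (hg j).dist_eq]
          rw [hf.dist_eq, h4] at h3
          rw [h1, h2]
          linarith }
  exact isHyperconvex_of_exists_mem fun S hS => hgluing.exists_mem hS
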